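/- **Continuous data.** Let $d\in\{2,3\}$ and let $\Omega\subset\mathbb R^d$ be a bounded connected polyhedral open set. Let $\eta:\mathbb R\to\mathbb R$ be continuous and even, with $\eta(0)=0$, $\eta>0$ on $\mathbb R\setminus\{0\}$, and non-decreasing on $[0,\infty)$. Let $p\in L^1_{\rm loc}([0,\infty))$ be absolutely continuous on compact subintervals of $(0,\infty)$ and increasing there, with $p'>0$ a.e., $p(u)\to+\infty$ as $u\to+\infty$, $\sqrt\eta\,p'\in L^1_{\rm loc}([0,\infty))$ and $\sqrt{\eta(u)}\,p(u)\to0$ as $u\searrow0$. Put $p(0)=\lim_{u\searrow0}p(u)\in[-\infty,\infty)$. If $p(0)>-\infty$, extend $p$ by $p(u)=2p(0)-p(-u)$ for $u\le 0$ and set $I_p=\mathbb R$; if $p(0)=-\infty$ set $I_p=(0,\infty)$. Let $\Gamma(u)=\int_1^u(p(a)-p(1))\,da$ for $u\in\overline{I_p}$ and $\Gamma(u)=+\infty$ otherwise, and $\xi(u)=\int_0^u\sqrt{\eta(a)}\,p'(a)\,da$ for $u\ge0$. Assume that $0\le\xi\le C(1+\Gamma)$ on $[0,\infty)$ for some $C>0$,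 that $\Gamma(u)/\eta(u)\to+\infty$ as $u\to+\infty$, and that $\sqrt{\eta\circ\xi^{-1}}$ is uniformly continuous on the range of $\xi$. Let $\Lambda\in L^\infty(\Omega)^{d\times d}$ be symmetric a.e. with $\lambda_\star|v|^2\le\Lambda(x)v\cdot v\le\lambda^\star|v|^2$ for all $v\in\mathbb R^d$ and a.e. $x\in\Omega$, where $0<\lambda_\star\le\lambda^\star<\infty$. Let $V$ be Lipschitz continuous on $\overline\Omega$. **Mesh.** Let $\mathcal M$ be a finite set of pairwise disjoint open cells $\kappa\subset\Omega$ with $\bigcup_\kappa\overline\kappa=\overline\Omega$, each star-shaped with respect to a center $x_\kappa\in\kappa$, whose boundary is the union of its faces. Let $\mathcal V$ be the finite set of vertices, located at $x_s\in\overline\Omega$, let $\mathcal V_\kappa$ and $\mathcal V_\sigma$ be the sets of vertices of the cell $\kappa$ and of the face $\sigma$, and let $\mathcal M_s=\{\kappa : s\in\mathcal V_\kappa\}$. If $d=2$ a face is the segment joining its two vertices. If $d=3$ a face $\sigma$ has a center $x_\sigma=\sum_{s\in\mathcal V_\sigma}\beta_{\sigma,s}x_s$ with $\beta_{\sigma,s}\ge0$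 and $\sum_{s\in\mathcal V_\sigma}\beta_{\sigma,s}=1$, and it is the union of the triangles spanned by $x_\sigma$ and the edges of $\sigma$. Joining $x_\kappa$ to the segments (resp. triangles) that make up its faces gives simplices, which are assumed to be nondegenerate and to form a conforming simplicial mesh $\mathcal T$. Let $W_{\mathcal D}=\mathbb R^{\mathcal M\cup\mathcal V}$. For $\mathbf v\in W_{\mathcal D}$ let $\pi_{\mathcal T}\mathbf v$ be the continuous function, affine on each simplex of $\mathcal T$, with value $v_\kappa$ at $x_\kappa$, $v_s$ at $x_s$ and, if $d=3$, $\sum_{s\in\mathcal V_\sigma}\beta_{\sigma,s}v_s$ at $x_\sigma$. **Mass lumping.** Let $\alpha_{\kappa,s}\ge0$ with $\sum_{s\in\mathcal V_\kappa}\alpha_{\kappa,s}\le1$, and set $m_{\kappa,s}=\alpha_{\kappa,s}\,{\rm meas}(\kappa)$, $m_s=\sum_{\kappa\in\mathcal M_s}m_{\kappa,s}$ and $m_\kappa={\rm meas}(\kappa)-\sum_{s\in\mathcal V_\kappa}m_{\kappa,s}$; assume that $m_\beta>0$ for all $\beta\in\mathcal M\cup\mathcal V$. Let $\omega_\kappa,\omega_{\kappa,s}$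 ($s\in\mathcal V_\kappa$) be disjoint open subsets of $\kappa$ of measures $m_\kappa,m_{\kappa,s}$ whose closures cover $\overline\kappa$, let $\omega_s=\bigcup_{\kappa\in\mathcal M_s}\omega_{\kappa,s}$, and let $\pi_{\mathcal D}\mathbf v=\sum_\kappa v_\kappa\mathbf 1_{\omega_\kappa}+\sum_s v_s\mathbf 1_{\omega_s}$. **Scheme.** Let $\mathbf V=(V(x_\kappa),V(x_s))_{\kappa,s}$, $\mathbf h(\mathbf u)=(p(u_\beta)+V_\beta)_{\beta\in\mathcal M\cup\mathcal V}$, $(\delta_\kappa\mathbf v)_s=v_\kappa-v_s$ for $s\in\mathcal V_\kappa$, $\eta_{\kappa,s}(\mathbf u)=\frac12(\eta(u_\kappa)+\eta(u_s))$, and $\mathbb A_\kappa=(a^\kappa_{s,s'})_{s,s'\in\mathcal V_\kappa}$ with $a^\kappa_{s,s'}=\int_\kappa\Lambda\nabla\pi_{\mathcal T}\mathbf e_s\cdot\nabla\pi_{\mathcal T}\mathbf e_{s'}\,dx$, where $\mathbf e_s$ is the canonical basis vector of $W_{\mathcal D}$ attached to $s$. Let $\mathbb M_\kappa(\mathbf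 u)={\rm diag}(\sqrt{\eta_{\kappa,s}(\mathbf u)})_{s\in\mathcal V_\kappa}$ and $\mathbb B_\kappa(\mathbf u)=\mathbb M_\kappa(\mathbf u)\mathbb A_\kappa\mathbb M_\kappa(\mathbf u)$. The discrete entropy is $$\mathcal E_{\mathcal D}(\mathbf v)=\int_\Omega\big(\Gamma(\pi_{\mathcal D}\mathbf v)+\pi_{\mathcal D}\mathbf v\,\pi_{\mathcal D}\mathbf V\big)\,dx\in(-\infty,+\infty].$$ A vector $\mathbf v\in W_{\mathcal D}$ is *admissible* if $v_\beta\in I_p$ for all $\beta\in\mathcal M\cup\mathcal V$. Given $\Delta t_n>0$ and $\mathbf u^{n-1}\in W_{\mathcal D}$, the scheme consists in finding an admissible $\mathbf u^n$ such that $$m_\kappa\frac{u_\kappa^n-u_\kappa^{n-1}}{\Delta t_n}+\sum_{s\in\mathcal V_\kappa}F_{\kappa,s}(\mathbf u^n)=0\quad\forall\kappa\in\mathcal M,\qquad m_s\frac{u_s^n-u_s^{n-1}}{\Delta t_n}+\sum_{\kappa\in\mathcal M_s}F_{s,\kappa}(\mathbf u^n)=0\quad\forall s\in\mathcal V,$$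 where, for $\kappa\in\mathcal M$ and $s\in\mathcal V_\kappa$, $F_{\kappa,s}(\mathbf u)=\sqrt{\eta_{\kappa,s}(\mathbf u)}\sum_{s'\in\mathcal V_\kappa}a^\kappa_{s,s'}\sqrt{\eta_{\kappa,s'}(\mathbf u)}\,\big(h_\kappa(\mathbf u)-h_{s'}(\mathbf u)\big)$ and $F_{s,\kappa}(\mathbf u)=-F_{\kappa,s}(\mathbf u)$. **Theorem.** Let $\mathbf u^{n-1}\in W_{\mathcal D}$ satisfy $\mathcal E_{\mathcal D}(\mathbf u^{n-1})<+\infty$ and, if $p(0)=-\infty$, also $\int_\Omega\pi_{\mathcal D}\mathbf u^{n-1}\,dx>0$. Then the scheme has at least one admissible solution $\mathbf u^n$, and every admissible solution satisfies $$\mathcal E_{\mathcal D}(\mathbf u^n)+\Delta t_n\sum_{\kappa\in\mathcal M}\delta_\kappa\mathbf h(\mathbf u^n)\cdot\mathbb B_\kappa(\mathbf u^n)\,\delta_\kappa\mathbf h(\mathbf u^n)\le\mathcal E_{\mathcal D}(\mathbf u^{n-1}).$$ -/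

import Mathlib

open MeasureTheory Set Filter Topology
open scoped ENNReal NNReal Matrix

namespace VAG

noncomputable section

/-! ### Data of the continuous problem -/

/-- The Euclidean space `ℝ^d`. -/
abbrev Space (d : ℕ) : Type := EuclideanSpace ℝ (Fin d)

/-- `p(0) = -∞`. -/
def PressureSingular (p : ℝ → ℝ) : Prop := Tendsto p (𝓝[>] 0) atBot

/-- The interval `I_p`: `(0,∞)` if `p(0) = -∞`, and the whole line otherwise. -/
def Ip (p : ℝ → ℝ) : Set ℝ := {u | PressureSingular p → 0 < u}

/-- The value `∫_1^u (p(a) - p(1)) da` of the entropy function (meaningful on the closure of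
`I_p`). -/
def entropyReal (p : ℝ → ℝ) (u : ℝ) : ℝ := ∫ a in (1 : ℝ)..u, (p a - p 1)

open Classical in
/-- The entropy function `Γ`, with values in `[0,+∞]`. The integral is nonnegative on the closure
of `I_p` because `p` is increasing; outside of that closure `Γ = +∞`. -/
def Gam (p : ℝ → ℝ) (u : ℝ) : ℝ≥0∞ :=
  if u ∈ closure (Ip p) then ENNReal.ofReal (entropyReal p u) else ⊤

/-- The function `ξ(u) = ∫_0^u √η(a) p'(a) da`, `u ≥ 0`. -/
def xi (η p : ℝ → ℝ) (u : ℝ) : ℝ := ∫ a in (0 : ℝ)..u, √(η a) * deriv p a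

/-- Assumptions on the mobility function, already extended to an even function on `ℝ`. -/
structure IsMobility (η : ℝ → ℝ) : Prop where
  continuous : Continuous η
  zero : η 0 = 0
  pos : ∀ u, u ≠ 0 → 0 < η u
  mono : MonotoneOn η (Ici 0)
  even : ∀ u, η (-u) = η u

/-- Assumptions on the pressure function. If `p(0) = -∞` only the values of `p` on `(0,∞)` matter;
otherwise `p(0)` is the (finite) right limit at `0` and `p` is extended by symmetry to `(-∞,0]`. -/
structure IsPressure (η p : ℝ → ℝ) : Prop where
  locallyIntegrable : LocallyIntegrableOn p (Ici 0)
  absolutelyContinuous : ∀ a b : ℝ, 0 < a → a ≤ b → AbsolutelyContinuousOnInterval p a b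
  strictMono : StrictMonoOn p (Ioi 0)
  deriv_pos : ∀ᵐ u ∂(volume.restrict (Ioi (0 : ℝ))), 0 < deriv p u
  tendsto_atTop : Tendsto p atTop atTop
  extension : PressureSingular p ∨
    (Tendsto p (𝓝[>] 0) (𝓝 (p 0)) ∧ ∀ u ≤ 0, p u = 2 * p 0 - p (-u))
  sqrt_mul_deriv : LocallyIntegrableOn (fun u => √(η u) * deriv p u) (Ici 0)
  sqrt_mul_tendsto : Tendsto (fun u => √(η u) * p u) (𝓝[>] 0) (𝓝 0)

/-- Compatibility assumptions between `ξ`, `η` and `Γ`. -/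
structure IsCompatible (η p : ℝ → ℝ) : Prop where
  xi_bound : ∃ C > 0, ∀ u, 0 ≤ u → 0 ≤ xi η p u ∧ xi η p u ≤ C * (1 + entropyReal p u)
  superlinear : Tendsto (fun u => entropyReal p u / η u) atTop atTop
  unifCont : UniformContinuousOn
    (fun y => √(η (Function.invFunOn (xi η p) (Ici 0) y))) (xi η p '' Ici 0)

/-- Assumptions on the permeability tensor field on `Ω`: measurable, symmetric, bounded and
uniformly elliptic. -/
structure IsPermeability {d : ℕ} (Ω : Set (Space d)) (L : Space d → Space d →L[ℝ] Space d) :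
    Prop where
  measurable : AEStronglyMeasurable L (volume.restrict Ω)
  symm : ∀ᵐ x ∂(volume.restrict Ω), ∀ v w, inner ℝ (L x v) w = inner ℝ v (L x w)
  elliptic : ∃ lmin lmax : ℝ, 0 < lmin ∧ lmin ≤ lmax ∧ ∀ᵐ x ∂(volume.restrict Ω), ∀ v,
    lmin * ‖v‖ ^ 2 ≤ inner ℝ (L x v) v ∧ inner ℝ (L x v) v ≤ lmax * ‖v‖ ^ 2

/-! ### The mesh -/

/-- Combinatorial and geometric data of a mesh with cells `M`, faces `F` and vertices `V`.
For `d = 3`, `faceEdges σ` is the set of the edges of the face `σ`, an edge being given by its pair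
of vertices. For `d = 2`, where a face is a segment, `faceEdges σ` consists of the pair of vertices
of `σ` alone (see `IsMesh.two_dim`). The weights `beta` are only used if `d = 3`. -/
structure MeshData (d : ℕ) (M F V : Type*) where
  cell : M → Set (Space d)
  cellCenter : M → Space d
  vertexPos : V → Space d
  cellFaces : M → Finset F
  faceVerts : F → Finset V
  faceEdges : F → Finset (Finset V)
  beta : F → V → ℝ

/-- The discrete space `W_D`: one value per cell and one per vertex. -/
abbrev W (M V : Type*) : Type _ := M ⊕ V → ℝ

namespace MeshData

variable {d : ℕ} {M F V : Type*} [Fintype M] [Fintype F] [Fintype V]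
  [DecidableEq M] [DecidableEq F] [DecidableEq V]

/-- The vertices of a cell. -/
def cellVerts (D : MeshData d M F V) (κ : M) : Finset V := (D.cellFaces κ).biUnion D.faceVerts

/-- The cells sharing a vertex. -/
def vertexCells (D : MeshData d M F V) (s : V) : Finset M :=
  Finset.univ.filter fun κ => s ∈ D.cellVerts κ

/-- The face center `x_σ = ∑ β_{σ,s} x_s`. -/
def faceCenter (D : MeshData d M F V) (σ : F) : Space d :=
  ∑ s ∈ D.faceVerts σ, D.beta σ s • D.vertexPos s

/-- The interpolation `I_σ(v) = ∑ β_{σ,s} v_s` at the face center. -/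
def faceInterp (D : MeshData d M F V) (v : W M V) (σ : F) : ℝ :=
  ∑ s ∈ D.faceVerts σ, D.beta σ s * v (Sum.inr s)

/-- Position of a node of the simplicial submesh: a cell center, a face center or a vertex. -/
def nodePos (D : MeshData d M F V) : M ⊕ F ⊕ V → Space d
  | Sum.inl κ => D.cellCenter κ
  | Sum.inr (Sum.inl σ) => D.faceCenter σ
  | Sum.inr (Sum.inr s) => D.vertexPos s

/-- Value at a node of the simplicial submesh of the reconstruction of `v`. -/
def nodeVal (D : MeshData d M F V) (v : W M V) : M ⊕ F ⊕ V → ℝ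
  | Sum.inl κ => v (Sum.inl κ)
  | Sum.inr (Sum.inl σ) => D.faceInterp v σ
  | Sum.inr (Sum.inr s) => v (Sum.inr s)

/-- The nodes spanning a piece of a face: for `d = 3` the triangle `T_{σ,e}` with vertices `x_σ` and
the end points of the edge `e`; for `d = 2` the segment between the end points of the face. -/
def pieceNodes (_D : MeshData d M F V) (σ : F) (e : Finset V) : Finset (M ⊕ F ⊕ V) :=
  (if d = 3 then {Sum.inr (Sum.inl σ)} else ∅) ∪ e.image fun s => Sum.inr (Sum.inr s)

/-- The nodes of the simplex `T_{κ,σ,e}` (which is `T_{κ,σ}` for `d = 2`). -/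
def simplexNodes (D : MeshData d M F V) (T : M × F × Finset V) : Finset (M ⊕ F ⊕ V) :=
  insert (Sum.inl T.1) (D.pieceNodes T.2.1 T.2.2)

/-- The closed convex hull of a finite set of nodes. -/
def hull (D : MeshData d M F V) (N : Finset (M ⊕ F ⊕ V)) : Set (Space d) :=
  convexHull ℝ (D.nodePos '' (N : Set (M ⊕ F ⊕ V)))

/-- The face `σ` as a subset of the space. -/
def faceSet (D : MeshData d M F V) (σ : F) : Set (Space d) :=
  ⋃ e ∈ D.faceEdges σ, D.hull (D.pieceNodes σ e)

/-- The (index set of the) simplicial submesh. -/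
def submesh (D : MeshData d M F V) : Set (M × F × Finset V) :=
  {T | T.2.1 ∈ D.cellFaces T.1 ∧ T.2.2 ∈ D.faceEdges T.2.1}

/-- `D` is a generalized polyhedral discretization of `Ω` whose simplicial submesh is a
(nondegenerate, conforming) simplicial mesh. -/
structure IsMesh (D : MeshData d M F V) (Ω : Set (Space d)) : Prop where
  cell_open : ∀ κ, IsOpen (D.cell κ)
  cell_subset : ∀ κ, D.cell κ ⊆ Ω
  cell_disjoint : Pairwise fun κ κ' => Disjoint (D.cell κ) (D.cell κ')
  cell_cover : ⋃ κ, closure (D.cell κ) = closure Ω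
  center_mem : ∀ κ, D.cellCenter κ ∈ D.cell κ
  cell_star : ∀ κ, StarConvex ℝ (D.cellCenter κ) (D.cell κ)
  cell_frontier : ∀ κ, frontier (D.cell κ) = ⋃ σ ∈ D.cellFaces κ, D.faceSet σ
  face_cell : ∀ σ, ∃ κ, σ ∈ D.cellFaces κ
  vertex_cell : ∀ s, ∃ κ, s ∈ D.cellVerts κ
  edge_card : ∀ σ, ∀ e ∈ D.faceEdges σ, e.card = 2
  face_verts : ∀ σ, D.faceVerts σ = (D.faceEdges σ).biUnion id
  two_dim : d = 2 → ∀ σ, D.faceEdges σ = {D.faceVerts σ}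
  beta_nonneg : d = 3 → ∀ σ, ∀ s ∈ D.faceVerts σ, 0 ≤ D.beta σ s
  beta_sum : d = 3 → ∀ σ, ∑ s ∈ D.faceVerts σ, D.beta σ s = 1
  simplex_nondegenerate : ∀ T ∈ D.submesh,
    AffineIndependent ℝ (fun n : {n // n ∈ D.simplexNodes T} => D.nodePos n)
  simplex_conforming : ∀ T ∈ D.submesh, ∀ T' ∈ D.submesh,
    D.hull (D.simplexNodes T) ∩ D.hull (D.simplexNodes T')
      = D.hull (D.simplexNodes T ∩ D.simplexNodes T')

/-- `x` has the barycentric coordinates `w` in the simplex `T` of the submesh. -/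
def IsBary (D : MeshData d M F V) (x : Space d) (T : M × F × Finset V) (w : M ⊕ F ⊕ V → ℝ) :
    Prop :=
  T ∈ D.submesh ∧ (∀ n ∈ D.simplexNodes T, 0 ≤ w n) ∧ ∑ n ∈ D.simplexNodes T, w n = 1 ∧
    ∑ n ∈ D.simplexNodes T, w n • D.nodePos n = x

open Classical in
/-- The `P1` finite element reconstruction `π_T v`: affine on each simplex of the submesh, with the
prescribed values at its nodes (the value does not depend on the simplex that is chosen, since the
submesh is conforming). -/
def recon (D : MeshData d M F V) (v : W M V) (x : Space d) : ℝ :=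
  if h : ∃ q : (M × F × Finset V) × (M ⊕ F ⊕ V → ℝ), D.IsBary x q.1 q.2 then
    ∑ n ∈ D.simplexNodes h.choose.1, h.choose.2 n * D.nodeVal v n
  else 0

/-- The reconstructed gradient `∇_T v = ∇ π_T v` (defined almost everywhere). -/
def gradT (D : MeshData d M F V) (v : W M V) (x : Space d) : Space d := gradient (D.recon v) x

/-- The basis vector `e_s` of `W_D` attached to a vertex. -/
def basisVertex (s : V) : W M V := Pi.single (Sum.inr s) 1

/-- The local matrix `A_κ`. -/
def matA (D : MeshData d M F V) (L : Space d → Space d →L[ℝ] Space d) (κ : M) :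
    Matrix {s // s ∈ D.cellVerts κ} {s // s ∈ D.cellVerts κ} ℝ :=
  Matrix.of fun s s' => ∫ x in D.cell κ,
    inner ℝ (L x (D.gradT (basisVertex s.1) x)) (D.gradT (basisVertex s'.1) x)

/-- The local difference operator `(δ_κ v)_s = v_κ - v_s`. -/
def del (D : MeshData d M F V) (κ : M) (v : W M V) : {s // s ∈ D.cellVerts κ} → ℝ :=
  fun s => v (Sum.inl κ) - v (Sum.inr s.1)

/-- The averaged mobility `η_{κ,s}`. -/
def etaAvg (η : ℝ → ℝ) (u : W M V) (κ : M) (s : V) : ℝ :=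
  (η (u (Sum.inl κ)) + η (u (Sum.inr s))) / 2

/-- The diagonal matrix `M_κ(u)`. -/
def matM (D : MeshData d M F V) (η : ℝ → ℝ) (κ : M) (u : W M V) :
    Matrix {s // s ∈ D.cellVerts κ} {s // s ∈ D.cellVerts κ} ℝ :=
  Matrix.diagonal fun s => √(etaAvg η u κ s.1)

/-- The matrix `B_κ(u) = M_κ(u) A_κ M_κ(u)`. -/
def matB (D : MeshData d M F V) (L : Space d → Space d →L[ℝ] Space d) (η : ℝ → ℝ) (κ : M)
    (u : W M V) : Matrix {s // s ∈ D.cellVerts κ} {s // s ∈ D.cellVerts κ} ℝ :=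
  D.matM η κ u * D.matA L κ * D.matM η κ u

/-- The discrete exterior potential. -/
def potential (D : MeshData d M F V) (Vext : Space d → ℝ) : W M V :=
  Sum.elim (fun κ => Vext (D.cellCenter κ)) (fun s => Vext (D.vertexPos s))

/-- The discrete hydrostatic pressure `h(u) = p(u) + V`. -/
def hydro (D : MeshData d M F V) (p : ℝ → ℝ) (Vext : Space d → ℝ) (u : W M V) : W M V :=
  fun b => p (u b) + D.potential Vext b

/-- The flux `F_{κ,s}(u)` from the cell `κ` to its vertex `s`. -/
def fluxCV (D : MeshData d M F V) (L : Space d → Space d →L[ℝ] Space d) (η p : ℝ → ℝ)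
    (Vext : Space d → ℝ) (u : W M V) (κ : M) (s : {s // s ∈ D.cellVerts κ}) : ℝ :=
  √(etaAvg η u κ s.1) * ∑ s' : {s // s ∈ D.cellVerts κ}, D.matA L κ s s' *
    √(etaAvg η u κ s'.1) *
      (D.hydro p Vext u (Sum.inl κ) - D.hydro p Vext u (Sum.inr s'.1))

/-- The flux `F_{s,κ}(u) = -F_{κ,s}(u)` from the vertex `s` to the cell `κ`. -/
def fluxVC (D : MeshData d M F V) (L : Space d → Space d →L[ℝ] Space d) (η p : ℝ → ℝ)
    (Vext : Space d → ℝ) (u : W M V) (κ : M) (s : {s // s ∈ D.cellVerts κ}) : ℝ :=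
  -D.fluxCV L η p Vext u κ s

end MeshData

/-! ### Mass lumping, discrete entropy, scheme -/

/-- Data of a mass lumping: the weights `α_{κ,s}`, and the sets `ω_κ`, `ω_{κ,s}`. -/
structure Lumping (d : ℕ) (M V : Type*) where
  alpha : M → V → ℝ
  omegaCell : M → Set (Space d)
  omegaCV : M → V → Set (Space d)

namespace Lumping

variable {d : ℕ} {M F V : Type*} [Fintype M] [Fintype F] [Fintype V]
  [DecidableEq M] [DecidableEq F] [DecidableEq V]

/-- `m_{κ,s} = α_{κ,s} meas(κ)`. -/
def massCV (P : Lumping d M V) (D : MeshData d M F V) (κ : M) (s : V) : ℝ :=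
  P.alpha κ s * volume.real (D.cell κ)

/-- The lumped masses `m_κ` and `m_s`. -/
def mass (P : Lumping d M V) (D : MeshData d M F V) : W M V :=
  Sum.elim
    (fun κ => volume.real (D.cell κ) - ∑ s ∈ D.cellVerts κ, P.massCV D κ s)
    (fun s => ∑ κ ∈ D.vertexCells s, P.massCV D κ s)

/-- The admissible mass lumpings for the mesh `D`. -/
structure IsLumping (P : Lumping d M V) (D : MeshData d M F V) : Prop where
  alpha_nonneg : ∀ κ, ∀ s ∈ D.cellVerts κ, 0 ≤ P.alpha κ s
  alpha_sum : ∀ κ, ∑ s ∈ D.cellVerts κ, P.alpha κ s ≤ 1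
  omegaCell_open : ∀ κ, IsOpen (P.omegaCell κ)
  omegaCV_open : ∀ κ, ∀ s ∈ D.cellVerts κ, IsOpen (P.omegaCV κ s)
  omegaCell_subset : ∀ κ, P.omegaCell κ ⊆ D.cell κ
  omegaCV_subset : ∀ κ, ∀ s ∈ D.cellVerts κ, P.omegaCV κ s ⊆ D.cell κ
  disjoint_cell : ∀ κ, ∀ s ∈ D.cellVerts κ, Disjoint (P.omegaCell κ) (P.omegaCV κ s)
  disjoint_cv : ∀ κ, ∀ s ∈ D.cellVerts κ, ∀ s' ∈ D.cellVerts κ, s ≠ s' →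
    Disjoint (P.omegaCV κ s) (P.omegaCV κ s')
  cover : ∀ κ, closure (P.omegaCell κ) ∪ ⋃ s ∈ D.cellVerts κ, closure (P.omegaCV κ s)
    = closure (D.cell κ)
  meas_cell : ∀ κ, volume.real (P.omegaCell κ) = P.mass D (Sum.inl κ)
  meas_cv : ∀ κ, ∀ s ∈ D.cellVerts κ, volume.real (P.omegaCV κ s) = P.massCV D κ s

/-- The set `ω_s`, the union of the `ω_{κ,s}` over the cells sharing the vertex `s`. -/
def omegaVertex (P : Lumping d M V) (D : MeshData d M F V) (s : V) : Set (Space d) :=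
  ⋃ κ ∈ D.vertexCells s, P.omegaCV κ s

/-- The piecewise constant reconstruction `π_D v`. -/
def reconD (P : Lumping d M V) (D : MeshData d M F V) (v : W M V) (x : Space d) : ℝ :=
  ∑ κ, (P.omegaCell κ).indicator (fun _ => v (Sum.inl κ)) x
    + ∑ s, (P.omegaVertex D s).indicator (fun _ => v (Sum.inr s)) x

/-- The discrete entropy `∫_Ω (Γ(π_D v) + π_D v π_D V) dx ∈ (-∞,+∞]`. Since `Γ ≥ 0`, the first part
is an integral with values in `[0,+∞]`; the second one is the integral of a bounded function. -/
def entropyD (P : Lumping d M V) (D : MeshData d M F V) (Ω : Set (Space d)) (p : ℝ → ℝ)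
    (Vext : Space d → ℝ) (v : W M V) : EReal :=
  ((∫⁻ x in Ω, Gam p (P.reconD D v x) : ℝ≥0∞) : EReal)
    + ((∫ x in Ω, P.reconD D v x * P.reconD D (D.potential Vext) x : ℝ) : EReal)

/-- The set `W_D^en` of the vectors of finite discrete entropy. -/
def FiniteEntropy (P : Lumping d M V) (D : MeshData d M F V) (Ω : Set (Space d)) (p : ℝ → ℝ)
    (Vext : Space d → ℝ) : Set (W M V) :=
  {v | P.entropyD D Ω p Vext v < ⊤}

/-- `u` solves the nonlinear system of the scheme with time step `dt` and previous state `uOld`. -/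
def SolvesScheme (P : Lumping d M V) (D : MeshData d M F V)
    (L : Space d → Space d →L[ℝ] Space d) (η p : ℝ → ℝ) (Vext : Space d → ℝ) (dt : ℝ)
    (uOld u : W M V) : Prop :=
  (∀ κ : M, P.mass D (Sum.inl κ) * ((u (Sum.inl κ) - uOld (Sum.inl κ)) / dt)
      + ∑ s : {s // s ∈ D.cellVerts κ}, D.fluxCV L η p Vext u κ s = 0) ∧
  (∀ s : V, P.mass D (Sum.inr s) * ((u (Sum.inr s) - uOld (Sum.inr s)) / dt)
      + ∑ κ : {κ // s ∈ D.cellVerts κ}, D.fluxVC L η p Vext u κ.1 ⟨s, κ.2⟩ = 0)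

end Lumping

/-- The set `W_D^ad` of the admissible states. -/
def Admissible (M V : Type*) (p : ℝ → ℝ) : Set (W M V) := {v | ∀ b, v b ∈ Ip p}

end

end VAG

set_option linter.unusedSectionVars false

/-! Energy estimate. Since F_{s,κ} = -F_{κ,s}, pairing the scheme with φ turns the fluxes into cell
sums of F_{κ,s} (δ_κ φ)_s (`sum_residual_mul`). The choice φ = 1 gives conservation of mass, and φ =
h(u) gives the dissipation. As Γ is convex with derivative p - p(1), the entropy lies above its
tangents (`IsPressure.entropyReal_sub_le`); the constant p(1) disappears by conservation of mass,
and the inequality follows for every admissible solution.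

Existence. The unknown is changed to the hydrostatic pressure z = h(u). Since p is a homeomorphism
from I_p onto ℝ, with inverse q, every real vector z gives an admissible state, and the residual is
a continuous vector field of z. By `exists_zero_of_inner_pos`, a form of Brouwer's theorem proved
through the absence of a C^1 retraction, it vanishes somewhere if it points outwards far from the
origin, that is, if the set where its inner product with z is nonpositive is bounded
(`exists_bound_of_sum_residual_nonpos`).

On that set each term (u_β - u_β^{n-1}) z_β and the dissipation in each cell are bounded. The terms
bound every z_β from above, and from below wherever u_β^{n-1} lies in the open set I_p. If p(0) =
-∞, this may leave only one index, supplied by the positive mass. The lower bound then spreads from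
there: A_κ is positive definite (`MeshData.IsMesh.matA_pos`), so the dissipation controls jumps of z
weighted by a mobility that is bounded below next to a node where z is, and connectedness of Ω links
all nodes (`MeshData.IsMesh.forall_of_propagates`). -/

namespace VAG

/-! ### Zeros of coercive continuous vector fields -/

section Brouwer

variable {E : Type*} [NormedAddCommGroup E] [InnerProductSpace ℝ E]

/-- Extending a Lipschitz map on a closed ball that vanishes on the sphere by zero does not
increase its Lipschitz constant. -/
lemma lipschitzWith_indicator_closedBall {g : E → E} {K : ℝ≥0} {R : ℝ}
    (hg : LipschitzOnWith K g (Metric.closedBall 0 R)) (h0 : ∀ x, ‖x‖ = R → g x = 0) :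
    LipschitzWith K ((Metric.closedBall (0 : E) R).indicator g) := by
  -- The segment from x to y crosses the sphere, where `g` vanishes, at a point no farther from x
  -- than y.
  have mixed : ∀ x y : E, ‖x‖ ≤ R → R < ‖y‖ → ‖g x‖ ≤ K * ‖x - y‖ := by
    intro x y hx hy
    have hc : Continuous fun t : ℝ => ‖x + t • (y - x)‖ := by fun_prop
    obtain ⟨t, ht, hte⟩ : ∃ t ∈ Icc (0 : ℝ) 1, ‖x + t • (y - x)‖ = R := by
      have := intermediate_value_Icc (zero_le_one (α := ℝ)) hc.continuousOn
      exact this ⟨by simpa using hx, by simpa using hy.le⟩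
    have h1 := hg.dist_le_mul x (by simpa using hx) (x + t • (y - x)) (by simp [hte])
    rw [h0 _ hte, dist_zero_right] at h1
    refine h1.trans (mul_le_mul_of_nonneg_left ?_ K.2)
    rw [dist_eq_norm, show x - (x + t • (y - x)) = t • (x - y) by module, norm_smul,
      Real.norm_of_nonneg ht.1]
    exact mul_le_of_le_one_left (norm_nonneg _) ht.2
  refine LipschitzWith.of_dist_le_mul fun x y => ?_
  by_cases hx : ‖x‖ ≤ R <;> by_cases hy : ‖y‖ ≤ R
  · have hx' : x ∈ Metric.closedBall (0 : E) R := by simpa using hx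
    have hy' : y ∈ Metric.closedBall (0 : E) R := by simpa using hy
    simpa [indicator_of_mem hx', indicator_of_mem hy'] using hg.dist_le_mul x hx' y hy'
  · have hx' : x ∈ Metric.closedBall (0 : E) R := by simpa using hx
    have hy' : y ∉ Metric.closedBall (0 : E) R := by simpa using hy
    simpa [indicator_of_mem hx', indicator_of_notMem hy', dist_eq_norm] using
      mixed x y hx (not_le.1 hy)
  · have hx' : x ∉ Metric.closedBall (0 : E) R := by simpa using hx
    have hy' : y ∈ Metric.closedBall (0 : E) R := by simpa using hy
    simpa [indicator_of_notMem hx', indicator_of_mem hy', dist_eq_norm, norm_sub_rev x y] using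
      mixed y x hy (not_le.1 hx)
  · have hx' : x ∉ Metric.closedBall (0 : E) R := by simpa using hx
    have hy' : y ∉ Metric.closedBall (0 : E) R := by simpa using hy
    simp only [indicator_of_notMem hx', indicator_of_notMem hy', dist_self]
    positivity

variable [FiniteDimensional ℝ E]

/-- Polynomial dependence on t, with degree at most the dimension, is what later carries an identity
from small t to t = 1. -/
lemma exists_polynomial_det_one_add_smul (A : E →L[ℝ] E) :
    ∃ q : Polynomial ℝ, q.degree < ((Module.finrank ℝ E + 1 : ℕ) : WithBot ℕ) ∧
      ∀ t : ℝ, (1 + t • A).det = q.eval t := by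
  classical
  set b := Module.finBasis ℝ E
  set N := LinearMap.toMatrix b b (A : E →ₗ[ℝ] E) with hN
  refine ⟨((Polynomial.X : Polynomial ℝ) • N.map Polynomial.C +
    (1 : Matrix _ _ ℝ).map Polynomial.C).det, ?_, fun t => ?_⟩
  · refine Polynomial.degree_le_natDegree.trans_lt ?_
    have h := Polynomial.natDegree_det_X_add_C_le N 1
    rw [Fintype.card_fin] at h
    exact_mod_cast Nat.lt_succ_of_le h
  · rw [← Polynomial.coe_evalRingHom, RingHom.map_det, ContinuousLinearMap.det,
      ← LinearMap.det_toMatrix b]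
    congr 1
    ext i j
    by_cases hij : i = j
    · subst hij
      simp [hN, LinearMap.toMatrix_apply, Matrix.add_apply, Matrix.map_apply, Matrix.smul_apply]
      ring
    · simp [hN, LinearMap.toMatrix_apply, hij]
      ring

/-- For t in [0,1] a kernel vector v of 1 + tA would satisfy ‖v‖ ≤ ‖A‖‖v‖ < ‖v‖. The determinant is
therefore continuous and nonzero along the path, and it starts from 1. -/
lemma det_one_add_pos_of_norm_lt_one (A : E →L[ℝ] E) (hA : ‖A‖ < 1) : 0 < (1 + A).det := by
  have hne : ∀ t ∈ Icc (0 : ℝ) 1, (1 + t • A).det ≠ 0 := by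
    intro t ht h
    obtain ⟨v, hv, hv0⟩ := (Submodule.ne_bot_iff _).1 (LinearMap.bot_lt_ker_of_det_eq_zero h).ne'
    have h1 : v = -(t • A v) := eq_neg_of_add_eq_zero_left (by simpa using hv)
    have h2 : ‖v‖ < ‖v‖ := by
      calc ‖v‖ = t * ‖A v‖ := by
            conv_lhs => rw [h1]
            rw [norm_neg, norm_smul, Real.norm_of_nonneg ht.1]
        _ ≤ ‖A v‖ := mul_le_of_le_one_left (norm_nonneg _) ht.2
        _ ≤ ‖A‖ * ‖v‖ := A.le_opNorm v
        _ < ‖v‖ := mul_lt_of_lt_one_left (norm_pos_iff.2 hv0) hA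
    exact lt_irrefl _ h2
  have hc : Continuous fun t : ℝ => (1 + t • A).det := by
    obtain ⟨q, -, hq⟩ := exists_polynomial_det_one_add_smul A
    simpa only [hq] using q.continuous
  by_contra hneg
  have h1 : (1 + (1 : ℝ) • A).det ≤ 0 := by simpa using hneg
  have h0 : (1 : ℝ) = (1 + (0 : ℝ) • A).det := by
    rw [zero_smul, add_zero]; exact LinearMap.det_id.symm
  obtain ⟨t, ht, h⟩ := intermediate_value_Icc' (zero_le_one (α := ℝ)) hc.continuousOn
    (show (0 : ℝ) ∈ _ from ⟨h1, h0 ▸ zero_le_one⟩)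
  exact hne t ht h

variable [MeasurableSpace E] [BorelSpace E]

/-- For small t the map x + t g(x), with g extended by zero outside the ball, is a Lipschitz
perturbation of the identity, hence a bijection of E fixing the complement of the open ball. It maps
the ball onto itself, and the change of variables formula gives the volume. -/
lemma integral_det_one_add_smul_fderiv {g : E → E} (hg : ContDiff ℝ 1 g) {R : ℝ}
    (h0 : ∀ x, ‖x‖ = R → g x = 0) :
    ∃ t₀ > 0, ∀ t ∈ Ioo (0 : ℝ) t₀,
      ∫ x in Metric.ball (0 : E) R, (1 + t • fderiv ℝ g x).det
        = volume.real (Metric.ball (0 : E) R) := by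
  have hcd : Continuous (fderiv ℝ g) := hg.continuous_fderiv one_ne_zero
  obtain ⟨C, hC⟩ := (isCompact_closedBall (0 : E) R).exists_bound_of_continuousOn hcd.continuousOn
  set K : ℝ≥0 := (max C 0).toNNReal with hK
  have hKC : ∀ x ∈ Metric.closedBall (0 : E) R, ‖fderiv ℝ g x‖ ≤ K := fun x hx => by
    rw [hK, Real.coe_toNNReal _ (le_max_right _ _)]; exact (hC x hx).trans (le_max_left _ _)
  have hlip : LipschitzOnWith K g (Metric.closedBall 0 R) :=
    (convex_closedBall 0 R).lipschitzOnWith_of_nnnorm_fderiv_le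
      (fun x _ => (hg.differentiable one_ne_zero) x) (fun x hx => hKC x hx)
  have hext := lipschitzWith_indicator_closedBall hlip h0
  -- This threshold forces t K < 1, even when K = 0.
  refine ⟨(K + 1 : ℝ)⁻¹, by positivity, fun t ht => ?_⟩
  have htK : t * K < 1 := by
    have : t * (K + 1) < 1 := by
      have := mul_lt_mul_of_pos_right ht.2 (show (0 : ℝ) < K + 1 by positivity)
      rwa [inv_mul_cancel₀ (by positivity)] at this
    nlinarith [ht.1]
  set G : E → E := (Metric.closedBall (0 : E) R).indicator g with hG
  set φ : E → E := fun x => x + t • G x with hφ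
  have happ : ApproximatesLinearOn φ ((ContinuousLinearEquiv.refl ℝ E : E ≃L[ℝ] E) : E →L[ℝ] E)
      univ (t.toNNReal * K) := by
    intro x _ y _
    have h1 := hext.dist_le_mul x y
    rw [dist_eq_norm, dist_eq_norm] at h1
    have : φ x - φ y - ((ContinuousLinearEquiv.refl ℝ E : E ≃L[ℝ] E) : E →L[ℝ] E) (x - y)
        = t • (G x - G y) := by
      simp only [hφ, ContinuousLinearEquiv.coe_coe, ContinuousLinearEquiv.refl_apply]; module
    rw [this, norm_smul, Real.norm_of_nonneg ht.1.le, NNReal.coe_mul, Real.coe_toNNReal _ ht.1.le,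
      mul_assoc]
    exact mul_le_mul_of_nonneg_left h1 ht.1.le
  have hcc : Subsingleton E ∨ t.toNNReal * K <
      ‖(((ContinuousLinearEquiv.refl ℝ E).symm : E ≃L[ℝ] E) : E →L[ℝ] E)‖₊⁻¹ := by
    rcases subsingleton_or_nontrivial E with h | h
    · exact Or.inl h
    · right
      have : ‖(((ContinuousLinearEquiv.refl ℝ E).symm : E ≃L[ℝ] E) : E →L[ℝ] E)‖₊ = 1 := by
        ext; exact ContinuousLinearMap.norm_id
      rw [this, inv_one, ← NNReal.coe_lt_coe]
      simpa [Real.coe_toNNReal _ ht.1.le] using htK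
  have hbij : Function.Bijective φ := ⟨injOn_univ.1 (happ.injOn hcc), happ.surjective hcc⟩
  have hout : ∀ x, x ∉ Metric.ball (0 : E) R → φ x = x := by
    intro x hx
    have : G x = 0 := by
      rw [hG]
      by_cases hx' : x ∈ Metric.closedBall (0 : E) R
      · rw [indicator_of_mem hx']
        exact h0 x (le_antisymm (by simpa using hx') (by simpa using hx))
      · exact indicator_of_notMem hx' _
    simp [hφ, this]
  have himg : φ '' Metric.ball (0 : E) R = Metric.ball 0 R := by
    have h1 := image_compl_eq hbij (s := Metric.ball (0 : E) R)
    have h2 : φ '' (Metric.ball (0 : E) R)ᶜ = (Metric.ball (0 : E) R)ᶜ := by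
      conv_rhs => rw [← image_id (Metric.ball (0 : E) R)ᶜ]
      exact image_congr fun x hx => hout x hx
    rw [h2] at h1
    exact (compl_injective h1).symm
  have hder : ∀ x ∈ Metric.ball (0 : E) R,
      HasFDerivWithinAt φ (1 + t • fderiv ℝ g x) (Metric.ball 0 R) x := by
    intro x hx
    have h1 : HasFDerivAt (fun x => x + t • g x) (1 + t • fderiv ℝ g x) x :=
      (hasFDerivAt_id x).add
        (((hg.differentiable one_ne_zero) x).hasFDerivAt.const_smul t)
    refine (h1.congr_of_eventuallyEq ?_).hasFDerivWithinAt
    filter_upwards [Metric.isOpen_ball.mem_nhds hx] with y hy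
    simp [hφ, hG, indicator_of_mem (Metric.ball_subset_closedBall hy)]
  have hcv := lintegral_abs_det_fderiv_eq_addHaar_image (volume : Measure E)
    Metric.isOpen_ball.measurableSet hder hbij.1.injOn
  rw [himg] at hcv
  have hpos : ∀ x ∈ Metric.ball (0 : E) R, 0 < (1 + t • fderiv ℝ g x).det := by
    intro x hx
    refine det_one_add_pos_of_norm_lt_one _ ?_
    rw [norm_smul, Real.norm_of_nonneg ht.1.le]
    exact (mul_le_mul_of_nonneg_left (hKC x (Metric.ball_subset_closedBall hx)) ht.1.le).trans_lt
      htK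
  rw [integral_eq_lintegral_of_nonneg_ae, measureReal_def, ← hcv]
  · congr 1
    refine setLIntegral_congr_fun Metric.isOpen_ball.measurableSet fun x hx => ?_
    simp only [abs_of_pos (hpos x hx)]
  · filter_upwards [ae_restrict_mem Metric.isOpen_ball.measurableSet] with x hx
    exact (hpos x hx).le
  · refine Continuous.aestronglyMeasurable ?_
    exact ContinuousLinearMap.continuous_det.comp (by fun_prop)

/-- There is no `C^1` retraction of a ball onto its boundary. -/
lemma no_contDiff_retraction {r : E → E} (hr : ContDiff ℝ 1 r) {R : ℝ} (hR : 0 < R)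
    (hn : ∀ x, ‖r x‖ = R) (hid : ∀ x, ‖x‖ = R → r x = x) : False := by
  classical
  set g : E → E := fun x => r x - x with hgd
  have hg : ContDiff ℝ 1 g := hr.sub contDiff_id
  obtain ⟨t₀, ht₀, hval⟩ := integral_det_one_add_smul_fderiv hg (R := R)
    (fun x hx => by simp [hgd, hid x hx])
  have hcd : Continuous (fderiv ℝ g) := hg.continuous_fderiv one_ne_zero
  set n := Module.finrank ℝ E
  -- One more node than the dimension, all distinct; the shift by 2 keeps even the first node
  -- strictly below `t₀`.
  set v : ℕ → ℝ := fun k => t₀ / (k + 2) with hv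
  have hvinj : InjOn v (Finset.range (n + 1) : Set ℕ) := by
    intro a _ b _ hab
    simp only [hv] at hab
    have h2 : (a : ℝ) + 2 = b + 2 := by
      have ha : (0 : ℝ) < a + 2 := by positivity
      have hb : (0 : ℝ) < b + 2 := by positivity
      rw [div_eq_div_iff ha.ne' hb.ne'] at hab
      exact (mul_left_cancel₀ ht₀.ne' hab).symm
    exact_mod_cast add_right_cancel h2
  have hvI : ∀ k, v k ∈ Ioo 0 t₀ := fun k => by
    constructor
    · simp only [hv]; positivity
    · simp only [hv]
      rw [div_lt_iff₀ (by positivity)]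
      nlinarith [show (0 : ℝ) ≤ k by positivity]
  -- Lagrange weights extrapolating a polynomial from the nodes to t = 1. They make the integral of
  -- det(1 + t Dg), constant for small t, take the same value at t = 1.
  set c : ℕ → ℝ := fun k => (Lagrange.basis (Finset.range (n + 1)) v k).eval 1 with hc
  have hinterp : ∀ A : E →L[ℝ] E, (1 + A).det =
      ∑ k ∈ Finset.range (n + 1), c k * (1 + v k • A).det := by
    intro A
    obtain ⟨q, hq, hqe⟩ := exists_polynomial_det_one_add_smul A
    have h1 := Lagrange.eq_interpolate hvinj (f := q) (by simpa using hq)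
    have h2 := hqe 1
    rw [one_smul] at h2
    rw [h2]
    conv_lhs => rw [h1]
    simp only [Lagrange.interpolate_apply, Polynomial.eval_finsetSum, Polynomial.eval_mul,
      Polynomial.eval_C, hqe, hc]
    exact Finset.sum_congr rfl fun k _ => mul_comm _ _
  have hsum : ∑ k ∈ Finset.range (n + 1), c k = 1 := by
    have := congrArg (Polynomial.eval 1) (Lagrange.sum_basis hvinj ⟨0, by simp⟩)
    simpa [Polynomial.eval_finsetSum, hc] using this
  -- Since ‖r‖ is constant, the range of the derivative of r at x is orthogonal to r(x) ≠ 0, so the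
  -- derivative is not onto.
  have hdet0 : ∀ x, (1 + fderiv ℝ g x).det = 0 := by
    intro x
    have hd : HasFDerivAt r (1 + fderiv ℝ g x) x := by
      have h1 := ((hr.differentiable one_ne_zero) x).hasFDerivAt
      have h2 : fderiv ℝ g x = fderiv ℝ r x - 1 :=
        (h1.sub (hasFDerivAt_id x)).fderiv
      rw [h2]; simpa using h1
    by_contra hne
    have horth : ∀ w, inner ℝ (r x) ((1 + fderiv ℝ g x) w) = 0 := by
      intro w
      have h1 := hd.inner ℝ hd
      have h2 : (fun y => inner ℝ (r y) (r y)) = fun _ => R ^ 2 := by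
        funext y; rw [real_inner_self_eq_norm_sq, hn]
      rw [h2] at h1
      have h3 := congrArg (fun f => f w) (h1.unique (hasFDerivAt_const _ _))
      simp only [ContinuousLinearMap.comp_apply, ContinuousLinearMap.prod_apply,
        fderivInnerCLM_apply, zero_apply] at h3
      rw [real_inner_comm (r x)] at h3
      linarith
    obtain ⟨w, hw⟩ := (LinearMap.equivOfDetNeZero _ hne).surjective (r x)
    have hw' : (1 + fderiv ℝ g x) w = r x := hw
    have h4 := horth w
    rw [hw', real_inner_self_eq_norm_sq, hn] at h4
    exact (pow_pos hR 2).ne' h4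
  have hI : ∀ t : ℝ, IntegrableOn (fun x => (1 + t • fderiv ℝ g x).det)
      (Metric.ball (0 : E) R) := by
    intro t
    have hcont : Continuous fun x => (1 + t • fderiv ℝ g x).det :=
      ContinuousLinearMap.continuous_det.comp (by fun_prop)
    exact (hcont.continuousOn.integrableOn_compact (isCompact_closedBall 0 R)).mono_set
      Metric.ball_subset_closedBall
  have hfin : (0 : ℝ) = volume.real (Metric.ball (0 : E) R) := by
    calc (0 : ℝ) = ∫ x in Metric.ball (0 : E) R, (1 + fderiv ℝ g x).det := by simp [hdet0]
      _ = ∑ k ∈ Finset.range (n + 1), c k *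
            ∫ x in Metric.ball (0 : E) R, (1 + v k • fderiv ℝ g x).det := by
          rw [show (fun x => (1 + fderiv ℝ g x).det) = fun x => ∑ k ∈ Finset.range (n + 1),
            c k * (1 + v k • fderiv ℝ g x).det from funext fun x => hinterp _,
            integral_finsetSum _ fun k _ => (hI (v k)).const_mul (c k)]
          simp_rw [integral_const_mul]
      _ = volume.real (Metric.ball (0 : E) R) := by
          rw [Finset.sum_congr rfl fun k _ => by rw [hval (v k) (hvI k)], ← Finset.sum_mul, hsum,
            one_mul]
  have hvol : 0 < volume.real (Metric.ball (0 : E) R) :=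
    ENNReal.toReal_pos (Metric.measure_ball_pos _ _ hR).ne' measure_ball_lt_top.ne
  exact hvol.ne hfin

end Brouwer

/-- A continuous vector field on a Euclidean space that points outwards outside of a ball has a
zero. -/
theorem exists_zero_of_inner_pos {E : Type*} [NormedAddCommGroup E] [InnerProductSpace ℝ E]
    [FiniteDimensional ℝ E] {G : E → E} (hG : Continuous G) {R : ℝ} (hR : 0 < R)
    (hpos : ∀ x, R ≤ ‖x‖ → 0 < inner ℝ (G x) x) : ∃ x, G x = 0 := by
  borelize E
  by_contra! hne
  -- The cutoff is 0 for ‖x‖ ≤ R and 1 for ‖x‖ ≥ R + 1. In between, H is a convex combination of two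
  -- fields having positive inner product with x, so it cannot vanish.
  set θ : E → ℝ := fun x => max 0 (min 1 (‖x‖ - R)) with hθ
  have hθc : Continuous θ := by fun_prop
  have hθ0 : ∀ x, 0 ≤ θ x := fun x => le_max_left _ _
  have hθ1 : ∀ x, θ x ≤ 1 := fun x => max_le zero_le_one (min_le_left _ _)
  set H : E → E := fun x => (1 - θ x) • G x + θ x • x with hH
  have hHc : Continuous H := by fun_prop
  have hHid : ∀ x, R + 1 ≤ ‖x‖ → H x = x := by
    intro x hx
    have : θ x = 1 := by
      simp only [hθ]; rw [min_eq_left (by linarith), max_eq_right zero_le_one]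
    simp [hH, this]
  have hHne : ∀ x, H x ≠ 0 := by
    intro x h
    rcases lt_or_ge ‖x‖ R with hx | hx
    · have : θ x = 0 := by
        simp only [hθ]; exact max_eq_left ((min_le_right _ _).trans (by linarith))
      apply hne x
      simpa [hH, this] using h
    · have h1 : inner ℝ (H x) x = (1 - θ x) * inner ℝ (G x) x + θ x * ‖x‖ ^ 2 := by
        simp only [hH, inner_add_left, real_inner_smul_left, real_inner_self_eq_norm_sq]
      rw [h, inner_zero_left] at h1
      have h2 := hpos x hx
      have h3 : 0 < ‖x‖ ^ 2 := by have := hR.trans_le hx; positivity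
      rcases (hθ0 x).eq_or_lt with h4 | h4
      · rw [← h4] at h1; linarith
      · nlinarith [mul_nonneg (sub_nonneg.2 (hθ1 x)) h2.le, mul_pos h4 h3]
  -- The smoothing error is below ‖H‖, which keeps K nonzero, and K is still the identity for ‖x‖ ≥
  -- R + 2. Normalizing K to length R + 2 then gives a forbidden retraction.
  obtain ⟨K, hKd, hKa, hKe, -⟩ := hHc.exists_contDiff_approx_and_eqOn 1 (ε := fun x => ‖H x‖)
    hHc.norm (fun x => norm_pos_iff.2 (hHne x)) (S := {x | R + 2 ≤ ‖x‖}) (U := {x | R + 1 < ‖x‖})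
    (isClosed_le continuous_const continuous_norm)
    ((isOpen_lt continuous_const continuous_norm).mem_nhdsSet.2
      (fun x (hx : R + 2 ≤ ‖x‖) => show R + 1 < ‖x‖ by linarith))
    (contDiff_id.contDiffOn.congr fun x (hx : R + 1 < ‖x‖) => hHid x hx.le)
  have hKne : ∀ x, K x ≠ 0 := by
    intro x h
    have := hKa x
    simp [h] at this
  have hR2 : 0 < R + 2 := by linarith
  refine no_contDiff_retraction (r := fun x => ((R + 2) / ‖K x‖) • K x) (R := R + 2) ?_ hR2 ?_ ?_
  · refine ContDiff.smul (contDiff_const.div (hKd.norm ℝ hKne) fun x => norm_ne_zero_iff.2 (hKne x))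
      hKd
  · intro x
    have := norm_pos_iff.2 (hKne x)
    rw [norm_smul, Real.norm_of_nonneg (by positivity)]
    field_simp
  · intro x hx
    have h1 : K x = x := by
      rw [hKe (show R + 2 ≤ ‖x‖ from hx.ge)]; exact hHid x (by linarith)
    simp only [h1, hx, div_self hR2.ne', one_smul]

/-! ### The pressure, its inverse and the entropy function -/

lemma Ip_of_singular {p : ℝ → ℝ} (h : PressureSingular p) : Ip p = Ioi 0 := by
  ext u; simp [Ip, h]

lemma Ip_of_not_singular {p : ℝ → ℝ} (h : ¬PressureSingular p) : Ip p = univ := by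
  ext u; simp [Ip, h]

lemma isOpen_Ip (p : ℝ → ℝ) : IsOpen (Ip p) := by
  by_cases h : PressureSingular p
  · rw [Ip_of_singular h]; exact isOpen_Ioi
  · rw [Ip_of_not_singular h]; exact isOpen_univ

lemma mem_Ip_of_pos {p : ℝ → ℝ} {u : ℝ} (hu : 0 < u) : u ∈ Ip p := fun _ => hu

lemma mem_Ip_of_lt {p : ℝ → ℝ} {u w : ℝ} (hw : w ∈ closure (Ip p)) (h : w < u) : u ∈ Ip p := by
  intro hs
  rw [Ip_of_singular hs, closure_Ioi, mem_Ici] at hw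
  exact hw.trans_lt h

lemma ordConnected_Ip (p : ℝ → ℝ) : (Ip p).OrdConnected :=
  ⟨fun _ hx _ _ _ hz hs => (hx hs).trans_le hz.1⟩

lemma exists_mem_Ip_lt {p : ℝ → ℝ} {w : ℝ} (hw : w ∈ Ip p) : ∃ u ∈ Ip p, u < w := by
  obtain ⟨l, hl, h⟩ := exists_Ioc_subset_of_mem_nhds ((isOpen_Ip p).mem_nhds hw) ⟨w - 1, by simp⟩
  exact ⟨(l + w) / 2, h ⟨by linarith, by linarith⟩, by linarith⟩

namespace IsPressure

variable {η p : ℝ → ℝ}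

lemma continuousOn_Ioi (hp : IsPressure η p) : ContinuousOn p (Ioi 0) := by
  intro u hu
  have hu : 0 < u := hu
  have h := (hp.absolutelyContinuous (u / 2) (2 * u) (by linarith) (by linarith)).continuousOn
  rw [uIcc_of_le (by linarith)] at h
  exact (h.continuousAt (Icc_mem_nhds (by linarith) (by linarith))).continuousWithinAt

lemma tendsto_zero (hp : IsPressure η p) (h : ¬PressureSingular p) :
    Tendsto p (𝓝[>] 0) (𝓝 (p 0)) := (hp.extension.resolve_left h).1

lemma neg_eq (hp : IsPressure η p) (h : ¬PressureSingular p) (u : ℝ) :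
    p (-u) = 2 * p 0 - p u := by
  have h2 := (hp.extension.resolve_left h).2
  rcases le_total 0 u with hu | hu
  · rw [h2 (-u) (by linarith), neg_neg]
  · rw [h2 u hu]; ring

lemma continuousOn_Ici (hp : IsPressure η p) (h : ¬PressureSingular p) :
    ContinuousOn p (Ici 0) := by
  intro u hu
  rcases (show (0 : ℝ) ≤ u from hu).eq_or_lt with rfl | hu
  · rw [← continuousWithinAt_Ioi_iff_Ici]
    exact hp.tendsto_zero h
  · exact (hp.continuousOn_Ioi.continuousAt (Ioi_mem_nhds hu)).continuousWithinAt

lemma strictMonoOn_Ici (hp : IsPressure η p) (h : ¬PressureSingular p) :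
    StrictMonoOn p (Ici 0) := by
  intro a ha b _ hab
  have hb : 0 < b := (show (0 : ℝ) ≤ a from ha).trans_lt hab
  rcases (show (0 : ℝ) ≤ a from ha).eq_or_lt with rfl | ha'
  · refine lt_of_le_of_lt (b := p (b / 2)) ?_
      (hp.strictMono (half_pos hb) hb (half_lt_self hb))
    refine le_of_tendsto (hp.tendsto_zero h) ?_
    filter_upwards [Ioo_mem_nhdsGT (half_pos hb)] with u hu
    exact (hp.strictMono hu.1 (half_pos hb) hu.2).le
  · exact hp.strictMono ha' hb hab

lemma strictMono_of_not_singular (hp : IsPressure η p) (h : ¬PressureSingular p) :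
    StrictMono p := by
  refine StrictMonoOn.Iic_union_Ici (a := 0) ?_ (hp.strictMonoOn_Ici h)
  intro a ha b hb hab
  have ha : a ≤ 0 := ha
  have hb : b ≤ 0 := hb
  have h1 := hp.strictMonoOn_Ici h (show 0 ≤ -b by linarith) (show 0 ≤ -a by linarith)
    (neg_lt_neg hab)
  rw [hp.neg_eq h, hp.neg_eq h] at h1
  linarith

lemma continuous_of_not_singular (hp : IsPressure η p) (h : ¬PressureSingular p) :
    Continuous p := by
  rw [← continuousOn_univ, ← Iic_union_Ici (a := (0 : ℝ))]
  refine ContinuousOn.union_of_isClosed ?_ (hp.continuousOn_Ici h) isClosed_Iic isClosed_Ici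
  have h1 : ContinuousOn (fun u => 2 * p 0 - p (-u)) (Iic 0) :=
    continuousOn_const.sub ((hp.continuousOn_Ici h).comp continuousOn_neg
      fun u (hu : u ≤ 0) => show 0 ≤ -u by linarith)
  exact h1.congr fun u _ => by simp only [hp.neg_eq h]; ring

lemma strictMonoOn_Ip (hp : IsPressure η p) : StrictMonoOn p (Ip p) := by
  by_cases h : PressureSingular p
  · rw [Ip_of_singular h]; exact hp.strictMono
  · exact (hp.strictMono_of_not_singular h).strictMonoOn _

lemma continuousOn_Ip (hp : IsPressure η p) : ContinuousOn p (Ip p) := by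
  by_cases h : PressureSingular p
  · rw [Ip_of_singular h]; exact hp.continuousOn_Ioi
  · exact (hp.continuous_of_not_singular h).continuousOn

/-- Arbitrarily large values come from the limit at +∞. Arbitrarily negative ones come from the
singularity at 0 or, without it, from the symmetry `neg_eq`. The intermediate value theorem fills
the gap. -/
lemma exists_mem_Ip_eq (hp : IsPressure η p) (y : ℝ) : ∃ u ∈ Ip p, p u = y := by
  have hhigh : ∀ y, ∃ b, 0 < b ∧ y ≤ p b := fun y =>
    ((eventually_gt_atTop 0).and (hp.tendsto_atTop.eventually_ge_atTop y)).exists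
  obtain ⟨b, hb, hyb⟩ := hhigh y
  obtain ⟨a, ha, hya⟩ : ∃ a ∈ Ip p, p a ≤ y := by
    by_cases h : PressureSingular p
    · obtain ⟨a, ha, ha'⟩ := ((eventually_mem_nhdsWithin (a := (0 : ℝ)) (s := Ioi 0)).and
        (Tendsto.eventually_le_atBot h y)).exists
      exact ⟨a, mem_Ip_of_pos ha, ha'⟩
    · obtain ⟨a, -, ha⟩ := hhigh (2 * p 0 - y)
      refine ⟨-a, fun h' => absurd h' h, ?_⟩
      rw [hp.neg_eq h]; linarith
  exact ((ordConnected_Ip p).isPreconnected.intermediate_value ha (mem_Ip_of_pos hb)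
    hp.continuousOn_Ip) ⟨hya, hyb⟩

end IsPressure

/-- `q` is the inverse of the pressure function, from `ℝ` onto `I_p`. -/
structure IsPressureInverse (p q : ℝ → ℝ) : Prop where
  mem : ∀ y, q y ∈ Ip p
  right_inv : ∀ y, p (q y) = y
  left_inv : ∀ u ∈ Ip p, q (p u) = u
  strictMono : StrictMono q
  continuous : Continuous q

namespace IsPressure

variable {η p : ℝ → ℝ}

/-- Continuity of q comes from monotonicity together with its image being the open set I_p. -/
lemma exists_inverse (hp : IsPressure η p) : ∃ q, IsPressureInverse p q := by
  choose q hq hpq using hp.exists_mem_Ip_eq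
  have hl : ∀ u ∈ Ip p, q (p u) = u := fun u hu => hp.strictMonoOn_Ip.injOn (hq _) hu (hpq _)
  have hmono : StrictMono q := fun a b hab =>
    (hp.strictMonoOn_Ip.lt_iff_lt (hq a) (hq b)).1 (by rwa [hpq, hpq])
  refine ⟨q, hq, hpq, hl, hmono, continuous_iff_continuousAt.2 fun y => ?_⟩
  refine continuousAt_of_monotoneOn_of_image_mem_nhds (hmono.monotone.monotoneOn univ) univ_mem ?_
  refine mem_of_superset ((isOpen_Ip p).mem_nhds (hq y)) fun u hu => ⟨p u, mem_univ _, hl u hu⟩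

lemma intervalIntegrable (hp : IsPressure η p) {a b : ℝ} (ha : a ∈ closure (Ip p))
    (hb : b ∈ closure (Ip p)) : IntervalIntegrable p volume a b := by
  by_cases h : PressureSingular p
  · rw [Ip_of_singular h, closure_Ioi] at ha hb
    refine IntegrableOn.intervalIntegrable ?_
    exact hp.locallyIntegrable.integrableOn_compact_subset
      (ordConnected_Ici.uIcc_subset ha hb) isCompact_uIcc
  · exact (hp.continuous_of_not_singular h).intervalIntegrable a b

/-- By monotonicity p is compared with p(u) on the open interval between w and u only. This allows w
to be an end point of I_p, where p has no meaningful value. -/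
lemma integral_sub_const_le (hp : IsPressure η p) {u w : ℝ} (hu : u ∈ Ip p)
    (hw : w ∈ closure (Ip p)) (e : ℝ) : ∫ a in w..u, (p a - e) ≤ (p u - e) * (u - w) := by
  have hi : ∀ a b, a ∈ closure (Ip p) → b ∈ closure (Ip p) →
      IntervalIntegrable (fun a => p a - e) volume a b := fun a b ha hb =>
    (hp.intervalIntegrable ha hb).sub intervalIntegrable_const
  have hu' := subset_closure hu
  rcases le_total w u with h | h
  · have := intervalIntegral.integral_mono_on_of_le_Ioo h (hi w u hw hu')
      (intervalIntegrable_const (c := p u - e)) fun x hx =>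
        sub_le_sub_right (hp.strictMonoOn_Ip.monotoneOn (mem_Ip_of_lt hw hx.1) hu hx.2.le) e
    rw [intervalIntegral.integral_const, smul_eq_mul] at this
    linarith
  · have := intervalIntegral.integral_mono_on_of_le_Ioo h
      (intervalIntegrable_const (c := p u - e)) (hi u w hu' hw) fun x hx =>
        sub_le_sub_right (hp.strictMonoOn_Ip.monotoneOn hu (mem_Ip_of_lt hu' hx.1) hx.1.le) e
    rw [intervalIntegral.integral_const, smul_eq_mul] at this
    rw [intervalIntegral.integral_symm]
    linarith

/-- The entropy function lies above its tangents. -/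
lemma entropyReal_sub_le (hp : IsPressure η p) {u w : ℝ} (hu : u ∈ Ip p)
    (hw : w ∈ closure (Ip p)) :
    entropyReal p u - entropyReal p w ≤ (p u - p 1) * (u - w) := by
  have h1 : (1 : ℝ) ∈ closure (Ip p) := subset_closure (mem_Ip_of_pos one_pos)
  rw [entropyReal, entropyReal, intervalIntegral.integral_interval_sub_left
    ((hp.intervalIntegrable h1 (subset_closure hu)).sub intervalIntegrable_const)
    ((hp.intervalIntegrable h1 hw).sub intervalIntegrable_const)]
  exact hp.integral_sub_const_le hu hw _

lemma entropyReal_nonneg (hp : IsPressure η p) {w : ℝ} (hw : w ∈ closure (Ip p)) :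
    0 ≤ entropyReal p w := by
  have := hp.entropyReal_sub_le (mem_Ip_of_pos one_pos) hw
  rw [entropyReal, intervalIntegral.integral_same] at this
  linarith

/-- With p(u₀) = -c, the product dominates the integral of p - p(u₀) from w to q(y). Splitting it at
u₀ leaves a nonnegative part and a part independent of y. The bound survives at w on the boundary of
I_p. -/
lemma exists_neg_le_mul (hp : IsPressure η p) {q : ℝ → ℝ} (hq : IsPressureInverse p q) {w : ℝ}
    (hw : w ∈ closure (Ip p)) (c : ℝ) : ∃ C, ∀ y, -C ≤ (q y - w) * (y + c) := by
  set u₀ := q (-c)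
  have hu₀ : u₀ ∈ Ip p := hq.mem _
  have hpu₀ : p u₀ = -c := hq.right_inv _
  have hi : ∀ a ∈ closure (Ip p), IntervalIntegrable (fun a => p a - p u₀) volume u₀ a :=
    fun a ha => (hp.intervalIntegrable (subset_closure hu₀) ha).sub intervalIntegrable_const
  refine ⟨∫ a in u₀..w, (p a - p u₀), fun y => ?_⟩
  have h1 := hp.integral_sub_const_le (hq.mem y) hw (p u₀)
  have h2 := hp.integral_sub_const_le hu₀ (subset_closure (hq.mem y)) (p u₀)
  rw [sub_self, zero_mul, intervalIntegral.integral_symm] at h2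
  rw [← intervalIntegral.integral_interval_sub_left (hi _ (subset_closure (hq.mem y))) (hi w hw),
    hq.right_inv y] at h1
  rw [hpu₀] at h1 h2
  rw [hpu₀]
  linarith

end IsPressure

namespace IsPressureInverse

variable {p q : ℝ → ℝ}

/-- For large y one has q(y) ≥ w + 1, so the product is at least y + c. -/
lemma exists_le_of_mul_le (hq : IsPressureInverse p q) (w c C : ℝ) :
    ∃ K, ∀ y, (q y - w) * (y + c) ≤ C → y ≤ K := by
  have hu : max w 0 + 1 ∈ Ip p := mem_Ip_of_pos (by positivity)
  refine ⟨max (p (max w 0 + 1)) (max C 0 - c), fun y hy => ?_⟩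
  by_contra! h
  have h1 : max w 0 + 1 < q y := by
    rw [← hq.left_inv _ hu]; exact hq.strictMono ((le_max_left _ _).trans_lt h)
  have h2 : max C 0 < y + c := by linarith [le_max_right (p (max w 0 + 1)) (max C 0 - c)]
  have h3 : 1 ≤ q y - w := by linarith [le_max_left w 0]
  have h4 := le_max_left C 0
  have h5 := le_max_right C 0
  nlinarith

/-- As I_p is open, some u < w lies in it, and w - q(y) stays above w - u for very negative y. At a
boundary point w this gap closes and no lower bound results. -/
lemma exists_ge_of_mul_le (hq : IsPressureInverse p q) {w : ℝ} (hw : w ∈ Ip p) (c C : ℝ) :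
    ∃ K, ∀ y, (q y - w) * (y + c) ≤ C → K ≤ y := by
  obtain ⟨u, hu, huw⟩ := exists_mem_Ip_lt hw
  refine ⟨min (p u) (-c - max C 0 / (w - u)), fun y hy => ?_⟩
  by_contra! h
  have h1 : q y < u := by
    rw [← hq.left_inv _ hu]; exact hq.strictMono (h.trans_le (min_le_left _ _))
  have h2 : max C 0 / (w - u) < -(y + c) := by
    linarith [min_le_right (p u) (-c - max C 0 / (w - u))]
  have hpos : 0 < w - u := sub_pos.2 huw
  rw [div_lt_iff₀ hpos] at h2
  have h4 := le_max_left C 0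
  have h5 := le_max_right C 0
  have h6 : 0 < -(y + c) := by nlinarith
  nlinarith

end IsPressureInverse

namespace MeshData

variable {d : ℕ} {M F V : Type*} [Fintype M] [Fintype F] [Fintype V]
  [DecidableEq M] [DecidableEq F] [DecidableEq V] {D : MeshData d M F V} {Ω : Set (Space d)}

/-! ### Geometry of the simplicial submesh -/

lemma mem_hull_iff {N : Finset (M ⊕ F ⊕ V)} {x : Space d} :
    x ∈ D.hull N ↔ ∃ w : M ⊕ F ⊕ V → ℝ, (∀ n ∈ N, 0 ≤ w n) ∧ ∑ n ∈ N, w n = 1 ∧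
      ∑ n ∈ N, w n • D.nodePos n = x := by
  constructor
  · intro hx
    let S : Set (Space d) := {x | ∃ w : M ⊕ F ⊕ V → ℝ, (∀ n ∈ N, 0 ≤ w n) ∧ ∑ n ∈ N, w n = 1 ∧
      ∑ n ∈ N, w n • D.nodePos n = x}
    refine convexHull_min (t := S) ?_ ?_ hx
    · rintro _ ⟨n, hn, rfl⟩
      have hn : n ∈ N := hn
      refine ⟨Pi.single n 1, fun m _ => ?_, by simp [Finset.sum_pi_single', hn], ?_⟩
      · by_cases h : m = n
        · subst h; simp
        · simp [h]
      · rw [Finset.sum_eq_single n]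
        · simp
        · intro m _ h; simp [h]
        · exact fun h => absurd hn h
    · rintro x ⟨w, hw, hw1, rfl⟩ y ⟨w', hw', hw1', rfl⟩ a b ha hb hab
      refine ⟨fun n => a * w n + b * w' n, fun n hn => ?_, ?_, ?_⟩
      · have := hw n hn
        have := hw' n hn
        positivity
      · rw [Finset.sum_add_distrib, ← Finset.mul_sum, ← Finset.mul_sum, hw1, hw1', mul_one, mul_one,
          hab]
      · simp_rw [add_smul, mul_smul]
        rw [Finset.sum_add_distrib, ← Finset.smul_sum, ← Finset.smul_sum]
  · rintro ⟨w, hw, hw1, rfl⟩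
    exact (convex_convexHull ℝ _).sum_mem hw hw1
      fun n hn => subset_convexHull ℝ _ ⟨n, hn, rfl⟩

lemma hull_mono {N N' : Finset (M ⊕ F ⊕ V)} (h : N ⊆ N') : D.hull N ⊆ D.hull N' :=
  convexHull_mono (image_mono h)

lemma nodePos_mem_hull {N : Finset (M ⊕ F ⊕ V)} {n : M ⊕ F ⊕ V} (h : n ∈ N) :
    D.nodePos n ∈ D.hull N := subset_convexHull ℝ _ ⟨n, h, rfl⟩

lemma convex_hull (N : Finset (M ⊕ F ⊕ V)) : Convex ℝ (D.hull N) := convex_convexHull ℝ _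

lemma card_pieceNodes (hd : d = 2 ∨ d = 3) {σ : F} {e : Finset V} (he : e.card = 2) :
    (D.pieceNodes σ e).card = d := by
  have hinj : Function.Injective fun s : V => (Sum.inr (Sum.inr s) : M ⊕ F ⊕ V) :=
    Sum.inr_injective.comp Sum.inr_injective
  unfold pieceNodes
  rw [Finset.card_union_of_disjoint, Finset.card_image_of_injective _ hinj, he]
  · rcases hd with rfl | rfl <;> simp
  · split_ifs <;> simp

lemma cellCenter_notMem_pieceNodes (κ : M) (σ : F) (e : Finset V) :
    Sum.inl κ ∉ D.pieceNodes σ e := by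
  unfold pieceNodes
  split_ifs <;> simp

lemma card_simplexNodes (hd : d = 2 ∨ d = 3) {T : M × F × Finset V} (he : T.2.2.card = 2) :
    (D.simplexNodes T).card = d + 1 := by
  rw [simplexNodes, Finset.card_insert_of_notMem (cellCenter_notMem_pieceNodes _ _ _),
    card_pieceNodes hd he]

lemma vertex_mem_simplexNodes {T : M × F × Finset V} {s : V} (hs : s ∈ T.2.2) :
    Sum.inr (Sum.inr s) ∈ D.simplexNodes T := by
  simp [simplexNodes, pieceNodes, hs]

lemma cell_mem_simplexNodes (T : M × F × Finset V) : Sum.inl T.1 ∈ D.simplexNodes T :=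
  Finset.mem_insert_self _ _

namespace IsMesh

/-- No sign is imposed on the weights: affine independence alone gives uniqueness. -/
lemma eq_of_sum_smul_eq (hD : D.IsMesh Ω) {T : M × F × Finset V} (hT : T ∈ D.submesh)
    {a b : M ⊕ F ⊕ V → ℝ}
    (h1 : ∑ n ∈ D.simplexNodes T, a n = ∑ n ∈ D.simplexNodes T, b n)
    (h2 : ∑ n ∈ D.simplexNodes T, a n • D.nodePos n = ∑ n ∈ D.simplexNodes T, b n • D.nodePos n) :
    ∀ n ∈ D.simplexNodes T, a n = b n := by
  intro n hn
  have h := affineIndependent_iff.1 (hD.simplex_nondegenerate T hT) Finset.univ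
    (fun n => a n - b n) ?_ ?_ ⟨n, hn⟩ (Finset.mem_univ _)
  · exact sub_eq_zero.1 h
  · rw [Finset.univ_eq_attach, Finset.sum_attach _ fun n => a n - b n, Finset.sum_sub_distrib, h1,
      sub_self]
  · rw [Finset.univ_eq_attach, Finset.sum_attach _ fun n => (a n - b n) • D.nodePos n]
    simp_rw [sub_smul]
    rw [Finset.sum_sub_distrib, h2, sub_self]

/-- Interpolated values do not depend on the simplex that is used. -/
lemma sum_bary_eq (hD : D.IsMesh Ω) {x : Space d} {T T' : M × F × Finset V}
    {w w' : M ⊕ F ⊕ V → ℝ} (h : D.IsBary x T w) (h' : D.IsBary x T' w') (f : M ⊕ F ⊕ V → ℝ) :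
    ∑ n ∈ D.simplexNodes T, w n * f n = ∑ n ∈ D.simplexNodes T', w' n * f n := by
  obtain ⟨hT, hw, hw1, hwx⟩ := h
  obtain ⟨hT', hw', hw1', hwx'⟩ := h'
  have hx : x ∈ D.hull (D.simplexNodes T ∩ D.simplexNodes T') := by
    rw [← hD.simplex_conforming T hT T' hT']
    exact ⟨mem_hull_iff.2 ⟨w, hw, hw1, hwx⟩, mem_hull_iff.2 ⟨w', hw', hw1', hwx'⟩⟩
  obtain ⟨c, -, hc1, hcx⟩ := mem_hull_iff.1 hx
  -- The coordinates of x in the common face, extended by zero, are by uniqueness its coordinates in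
  -- each of the two simplices.
  have key : ∀ (S S' : M × F × Finset V) (v : M ⊕ F ⊕ V → ℝ), S ∈ D.submesh →
      ∑ n ∈ D.simplexNodes S ∩ D.simplexNodes S', c n = 1 →
      ∑ n ∈ D.simplexNodes S ∩ D.simplexNodes S', c n • D.nodePos n = x →
      ∑ n ∈ D.simplexNodes S, v n = 1 → ∑ n ∈ D.simplexNodes S, v n • D.nodePos n = x →
      ∑ n ∈ D.simplexNodes S, v n * f n
        = ∑ n ∈ D.simplexNodes S ∩ D.simplexNodes S', c n * f n := by
    intro S S' v hS hc1 hcx hv1 hvx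
    have h := hD.eq_of_sum_smul_eq hS (a := v)
      (b := fun n => if n ∈ D.simplexNodes S' then c n else 0)
      (by rw [Finset.sum_ite_mem, hc1, hv1])
      (by simp_rw [ite_smul, zero_smul]; rw [Finset.sum_ite_mem, hcx, hvx])
    rw [Finset.sum_congr rfl fun n hn => by rw [h n hn]]
    simp_rw [ite_mul, zero_mul]
    rw [Finset.sum_ite_mem]
  rw [key T T' w hT hc1 hcx hw1 hwx]
  rw [Finset.inter_comm] at hc1 hcx ⊢
  exact (key T' T w' hT' hc1 hcx hw1' hwx').symm

lemma affineSpan_simplex (hd : d = 2 ∨ d = 3) (hD : D.IsMesh Ω) {T : M × F × Finset V}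
    (hT : T ∈ D.submesh) :
    affineSpan ℝ (range fun n : {n // n ∈ D.simplexNodes T} => D.nodePos n) = ⊤ := by
  rw [(hD.simplex_nondegenerate T hT).affineSpan_eq_top_iff_card_eq_finrank_add_one,
    Fintype.card_coe, card_simplexNodes hd (hD.edge_card _ _ hT.2), finrank_euclideanSpace_fin]

lemma interior_hull_nonempty (hd : d = 2 ∨ d = 3) (hD : D.IsMesh Ω) {T : M × F × Finset V}
    (hT : T ∈ D.submesh) : (interior (D.hull (D.simplexNodes T))).Nonempty := by
  rw [hull, interior_convexHull_nonempty_iff_affineSpan_eq_top, ← hD.affineSpan_simplex hd hT]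
  congr 1
  ext x
  simp

/-- Affine interpolation on a simplex. -/
lemma exists_interpolation (hd : d = 2 ∨ d = 3) (hD : D.IsMesh Ω) {T : M × F × Finset V}
    (hT : T ∈ D.submesh) (f : M ⊕ F ⊕ V → ℝ) :
    ∃ (g : Space d) (c : ℝ), ∀ n ∈ D.simplexNodes T, inner ℝ g (D.nodePos n) + c = f n := by
  classical
  let b : AffineBasis {n // n ∈ D.simplexNodes T} ℝ (Space d) :=
    ⟨fun n => D.nodePos n, hD.simplex_nondegenerate T hT, hD.affineSpan_simplex hd hT⟩
  -- The linear part of the interpolant; its Riesz representative is the gradient.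
  let ℓ : Space d →ₗ[ℝ] ℝ := ∑ n : {n // n ∈ D.simplexNodes T}, f n • (b.coord n).linear
  refine ⟨(InnerProductSpace.toDual ℝ (Space d)).symm (LinearMap.toContinuousLinearMap ℓ),
    ∑ n : {n // n ∈ D.simplexNodes T}, f n * b.coord n 0, fun m hm => ?_⟩
  have hdec : ∀ n x, b.coord n x = (b.coord n).linear x + b.coord n 0 := fun n x =>
    congrFun (b.coord n).decomp x
  have hm' : D.nodePos m = b ⟨m, hm⟩ := rfl
  rw [InnerProductSpace.toDual_symm_apply, LinearMap.coe_toContinuousLinearMap']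
  simp only [ℓ, LinearMap.sum_apply, LinearMap.smul_apply, smul_eq_mul]
  rw [← Finset.sum_add_distrib]
  simp_rw [← mul_add, ← hdec]
  rw [hm']
  simp [b.coord_apply]

/-- On each simplex of the submesh the reconstruction is affine. -/
lemma exists_gradT_eq (hd : d = 2 ∨ d = 3) (hD : D.IsMesh Ω) {T : M × F × Finset V}
    (hT : T ∈ D.submesh) (v : W M V) :
    ∃ (g : Space d) (c : ℝ),
      (∀ n ∈ D.simplexNodes T, inner ℝ g (D.nodePos n) + c = D.nodeVal v n) ∧
      ∀ x ∈ interior (D.hull (D.simplexNodes T)), D.gradT v x = g := by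
  obtain ⟨g, c, hgc⟩ := hD.exists_interpolation hd hT (D.nodeVal v)
  refine ⟨g, c, hgc, fun x hx => ?_⟩
  have hrec : ∀ y ∈ D.hull (D.simplexNodes T), D.recon v y = inner ℝ g y + c := by
    intro y hy
    obtain ⟨w, hw, hw1, hwy⟩ := mem_hull_iff.1 hy
    have hb : D.IsBary y T w := ⟨hT, hw, hw1, hwy⟩
    have hex : ∃ q : (M × F × Finset V) × (M ⊕ F ⊕ V → ℝ), D.IsBary y q.1 q.2 := ⟨(T, w), hb⟩
    rw [recon, dif_pos hex, hD.sum_bary_eq hex.choose_spec hb,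
      Finset.sum_congr rfl fun n hn => by rw [← hgc n hn, mul_add], Finset.sum_add_distrib,
      ← Finset.sum_mul, hw1, one_mul, ← hwy, inner_sum]
    simp_rw [real_inner_smul_right]
  refine HasGradientAt.gradient ?_
  rw [hasGradientAt_iff_hasFDerivAt]
  have h1 : HasFDerivAt (fun y => inner ℝ g y + c) (InnerProductSpace.toDual ℝ (Space d) g) x :=
    ((InnerProductSpace.toDual ℝ (Space d) g).hasFDerivAt (x := x)).add_const c
  refine h1.congr_of_eventuallyEq ?_
  filter_upwards [mem_interior_iff_mem_nhds.1 hx] with y hy using hrec y hy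

/-- The point y lies in a piece of a face, and the simplex is the convex hull of that piece and the
cell center. -/
lemma exists_mem_hull_of_mem_frontier (hD : D.IsMesh Ω) {κ : M} {x y : Space d}
    (hy : y ∈ frontier (D.cell κ)) (hx : x ∈ segment ℝ (D.cellCenter κ) y) :
    ∃ T ∈ D.submesh, T.1 = κ ∧ x ∈ D.hull (D.simplexNodes T) := by
  rw [hD.cell_frontier] at hy
  simp only [faceSet, mem_iUnion] at hy
  obtain ⟨σ, hσ, e, he, hy⟩ := hy
  refine ⟨(κ, σ, e), ⟨hσ, he⟩, rfl, ?_⟩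
  refine (convex_hull _).segment_subset ?_ ?_ hx
  · exact nodePos_mem_hull (n := Sum.inl κ) (cell_mem_simplexNodes _)
  · exact hull_mono (Finset.subset_insert _ _) hy

lemma cell_bounded (hD : D.IsMesh Ω) (hΩ : Bornology.IsBounded Ω) (κ : M) :
    Bornology.IsBounded (D.cell κ) := hΩ.subset (hD.cell_subset κ)

/-- The part beyond x of the ray from the center through x is connected and unbounded. Without
meeting the frontier it would stay in the bounded cell. -/
lemma exists_mem_frontier_of_mem_cell (hD : D.IsMesh Ω) (hΩ : Bornology.IsBounded Ω) {κ : M}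
    {x : Space d} (hx : x ∈ D.cell κ) (hne : x ≠ D.cellCenter κ) :
    ∃ y ∈ frontier (D.cell κ), x ∈ segment ℝ (D.cellCenter κ) y := by
  set x₀ := D.cellCenter κ with hx₀
  let r : ℝ → Space d := fun t => x₀ + t • (x - x₀)
  have hr : Continuous r := by fun_prop
  have hpre : IsPreconnected (r '' Ici 1) := isPreconnected_Ici.image r hr.continuousOn
  have hr1 : r 1 = x := by simp [r]
  obtain ⟨t, ht, hft⟩ : ∃ t ∈ Ici (1 : ℝ), r t ∈ frontier (D.cell κ) := by
    by_contra! hno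
    have hsub : r '' Ici 1 ⊆ D.cell κ ∪ (closure (D.cell κ))ᶜ := by
      rintro _ ⟨t, ht, rfl⟩
      by_contra hcon
      simp only [mem_union, mem_compl_iff, not_or, not_not] at hcon
      exact hno t ht ⟨hcon.2, by rw [(hD.cell_open κ).interior_eq]; exact hcon.1⟩
    have hdisj : Disjoint (D.cell κ) (closure (D.cell κ))ᶜ :=
      disjoint_compl_right.mono_left subset_closure
    have hin : r '' Ici 1 ⊆ D.cell κ :=
      hpre.subset_left_of_subset_union (hD.cell_open κ) isClosed_closure.isOpen_compl hdisj hsub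
        ⟨x, ⟨1, self_mem_Ici, hr1⟩, hx⟩
    obtain ⟨C, hC⟩ := (hD.cell_bounded hΩ κ).exists_norm_le
    have hpos : 0 < ‖x - x₀‖ := norm_pos_iff.2 (sub_ne_zero.2 hne)
    set t := max 1 ((C + ‖x₀‖ + 1) / ‖x - x₀‖) with ht
    have h1 := hC _ (hin ⟨t, mem_Ici.2 (le_max_left _ _), rfl⟩)
    have h2 : t * ‖x - x₀‖ ≤ ‖r t‖ + ‖x₀‖ := by
      have h3 : t * ‖x - x₀‖ = ‖r t - x₀‖ := by
        rw [show r t - x₀ = t • (x - x₀) by simp [r], norm_smul,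
          Real.norm_of_nonneg (zero_le_one.trans (le_max_left _ _))]
      rw [h3]
      exact norm_sub_le _ _
    have h3 : C + ‖x₀‖ + 1 ≤ t * ‖x - x₀‖ := by
      rw [← div_le_iff₀ hpos]; exact le_max_right _ _
    linarith
  have ht : 1 ≤ t := ht
  refine ⟨r t, hft, ?_⟩
  rw [segment_eq_image']
  refine ⟨t⁻¹, ⟨by positivity, inv_le_one_of_one_le₀ ht⟩, ?_⟩
  simp only [r, add_sub_cancel_left, smul_smul]
  rw [inv_mul_cancel₀ (by positivity), one_smul, add_sub_cancel]

lemma frontier_cell_nonempty (hd : d = 2 ∨ d = 3) (hD : D.IsMesh Ω) (hΩ : Bornology.IsBounded Ω)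
    (κ : M) : (frontier (D.cell κ)).Nonempty := by
  have : Nonempty (Fin d) := ⟨⟨0, by omega⟩⟩
  rw [nonempty_frontier_iff]
  refine ⟨⟨_, hD.center_mem κ⟩, fun h => ?_⟩
  exact NoncompactSpace.noncompact_univ (X := Space d)
    (Metric.isCompact_of_isClosed_isBounded isClosed_univ (h ▸ hD.cell_bounded hΩ κ))

/-- The closure of a cell is covered by its simplices. -/
lemma exists_mem_hull_of_mem_closure (hd : d = 2 ∨ d = 3) (hD : D.IsMesh Ω)
    (hΩ : Bornology.IsBounded Ω) {κ : M} {x : Space d} (hx : x ∈ closure (D.cell κ)) :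
    ∃ T ∈ D.submesh, T.1 = κ ∧ x ∈ D.hull (D.simplexNodes T) := by
  rw [closure_eq_self_union_frontier] at hx
  rcases hx with hx | hx
  · by_cases hne : x = D.cellCenter κ
    · obtain ⟨y, hy⟩ := hD.frontier_cell_nonempty hd hΩ κ
      exact hD.exists_mem_hull_of_mem_frontier hy (hne ▸ left_mem_segment ℝ _ _)
    · obtain ⟨y, hy, hxy⟩ := hD.exists_mem_frontier_of_mem_cell hΩ hx hne
      exact hD.exists_mem_hull_of_mem_frontier hy hxy
  · exact hD.exists_mem_hull_of_mem_frontier hx (right_mem_segment ℝ _ _)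

/-- Cells with intersecting closures share a vertex. -/
lemma exists_common_vertex (hd : d = 2 ∨ d = 3) (hD : D.IsMesh Ω) (hΩ : Bornology.IsBounded Ω)
    {κ κ' : M} (hne : κ ≠ κ') (h : (closure (D.cell κ) ∩ closure (D.cell κ')).Nonempty) :
    ∃ s, s ∈ D.cellVerts κ ∧ s ∈ D.cellVerts κ' := by
  obtain ⟨x, hx, hx'⟩ := h
  obtain ⟨T, hT, rfl, hxT⟩ := hD.exists_mem_hull_of_mem_closure hd hΩ hx
  obtain ⟨T', hT', rfl, hxT'⟩ := hD.exists_mem_hull_of_mem_closure hd hΩ hx'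
  have hx : x ∈ D.hull (D.simplexNodes T ∩ D.simplexNodes T') := by
    rw [← hD.simplex_conforming T hT T' hT']; exact ⟨hxT, hxT'⟩
  have hvert : ∀ S ∈ D.submesh, ∀ s ∈ S.2.2, s ∈ D.faceVerts S.2.1 := fun S hS s hs => by
    rw [hD.face_verts]; exact Finset.mem_biUnion.2 ⟨S.2.2, hS.2, hs⟩
  have hcv : ∀ S ∈ D.submesh, ∀ s ∈ D.faceVerts S.2.1, s ∈ D.cellVerts S.1 := fun S hS s hs =>
    Finset.mem_biUnion.2 ⟨_, hS.1, hs⟩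
  -- The hull of no nodes is empty, yet it contains x.
  obtain ⟨n, hn⟩ : (D.simplexNodes T ∩ D.simplexNodes T').Nonempty := by
    by_contra hemp
    rw [Finset.not_nonempty_iff_eq_empty] at hemp
    simp [hull, hemp] at hx
  rw [Finset.mem_inter] at hn
  obtain ⟨hn, hn'⟩ := hn
  have hcases : ∀ S : M × F × Finset V, n ∈ D.simplexNodes S →
      n = Sum.inl S.1 ∨ n = Sum.inr (Sum.inl S.2.1) ∨ ∃ s ∈ S.2.2, Sum.inr (Sum.inr s) = n := by
    intro S h
    simp only [simplexNodes, pieceNodes, Finset.mem_insert, Finset.mem_union,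
      Finset.mem_image] at h
    rcases h with h | h | h
    · exact Or.inl h
    · split_ifs at h
      · exact Or.inr (Or.inl (by simpa using h))
      · simp at h
    · exact Or.inr (Or.inr h)
  -- A common node cannot be a cell center, the cells being distinct. If it is a face center, the
  -- face is common and so are its vertices; otherwise it is a vertex itself.
  rcases hcases T hn with rfl | rfl | ⟨s, hs, rfl⟩ <;>
    rcases hcases T' hn' with h | h | ⟨s', hs', h⟩ <;>
    simp only [Sum.inl.injEq, Sum.inr.injEq, reduceCtorEq] at h
  · exact absurd h hne
  · obtain ⟨s, hs⟩ : T.2.2.Nonempty := by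
      rw [← Finset.card_pos, hD.edge_card _ _ hT.2]; norm_num
    exact ⟨s, hcv T hT s (hvert T hT s hs), hcv T' hT' s (h ▸ hvert T hT s hs)⟩
  · subst h
    exact ⟨s', hcv T hT s' (hvert T hT s' hs), hcv T' hT' s' (hvert T' hT' s' hs')⟩

/-- A property that passes from a cell to its vertices and from a vertex to the cells around it
holds everywhere as soon as it holds somewhere. -/
lemma forall_of_propagates (hd : d = 2 ∨ d = 3) (hD : D.IsMesh Ω) (hΩ : Bornology.IsBounded Ω)
    (hΩc : IsConnected Ω) {Q : M ⊕ V → Prop}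
    (h1 : ∀ κ, ∀ s ∈ D.cellVerts κ, Q (Sum.inl κ) → Q (Sum.inr s))
    (h2 : ∀ κ, ∀ s ∈ D.cellVerts κ, Q (Sum.inr s) → Q (Sum.inl κ))
    (b₀ : M ⊕ V) (hb₀ : Q b₀) : ∀ b, Q b := by
  classical
  have hcell : ∃ κ₀, Q (Sum.inl κ₀) := by
    rcases b₀ with κ | s
    · exact ⟨κ, hb₀⟩
    · obtain ⟨κ, hκ⟩ := hD.vertex_cell s
      exact ⟨κ, h2 κ s hκ hb₀⟩
  obtain ⟨κ₀, hκ₀⟩ := hcell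
  have hcl : ∀ κ, (closure Ω ∩ closure (D.cell κ)).Nonempty := fun κ =>
    ⟨D.cellCenter κ, subset_closure (hD.cell_subset κ (hD.center_mem κ)),
      subset_closure (hD.center_mem κ)⟩
  have hall : ∀ κ, Q (Sum.inl κ) := by
    by_contra! hno
    obtain ⟨κ₁, hκ₁⟩ := hno
    have hclosed : ∀ A : Set M, IsClosed (⋃ κ ∈ A, closure (D.cell κ)) := fun A =>
      (toFinite A).isClosed_biUnion fun _ _ => isClosed_closure
    -- The closed cells satisfying Q and those violating it form two closed sets covering the
    -- connected set `closure Ω`, so the two must meet; the two cells meeting there share a vertex,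
    -- which carries Q across.
    obtain ⟨x, -, hx, hx'⟩ := isPreconnected_closed_iff.1 hΩc.isPreconnected.closure
      (⋃ κ ∈ {κ | Q (Sum.inl κ)}, closure (D.cell κ))
      (⋃ κ ∈ {κ | ¬Q (Sum.inl κ)}, closure (D.cell κ)) (hclosed _) (hclosed _)
      (by
        rw [← hD.cell_cover]
        intro x hx
        obtain ⟨κ, hκ⟩ := mem_iUnion.1 hx
        by_cases hQ : Q (Sum.inl κ)
        · exact Or.inl (mem_biUnion (show κ ∈ {κ | Q (Sum.inl κ)} from hQ) hκ)
        · exact Or.inr (mem_biUnion (show κ ∈ {κ | ¬Q (Sum.inl κ)} from hQ) hκ))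
      ((hcl κ₀).mono (inter_subset_inter_right _
        (subset_biUnion_of_mem (u := fun κ => closure (D.cell κ))
          (show κ₀ ∈ {κ | Q (Sum.inl κ)} from hκ₀))))
      ((hcl κ₁).mono (inter_subset_inter_right _
        (subset_biUnion_of_mem (u := fun κ => closure (D.cell κ))
          (show κ₁ ∈ {κ | ¬Q (Sum.inl κ)} from hκ₁))))
    simp only [mem_iUnion, mem_ofPred_eq, exists_prop] at hx hx'
    obtain ⟨κ, hκ, hxκ⟩ := hx
    obtain ⟨κ', hκ', hxκ'⟩ := hx'
    obtain ⟨s, hs, hs'⟩ := hD.exists_common_vertex hd hΩ (fun h : κ = κ' => hκ' (h ▸ hκ))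
      ⟨x, hxκ, hxκ'⟩
    exact hκ' (h2 κ' s hs' (h1 κ s hs hκ))
  rintro (κ | s)
  · exact hall κ
  · obtain ⟨κ, hκ⟩ := hD.vertex_cell s
    exact h1 κ s hκ (hall κ)

/-- A piece has only d nodes, so its affine span has dimension at most d - 1. -/
lemma volume_hull_pieceNodes (hd : d = 2 ∨ d = 3) {σ : F} {e : Finset V} (he : e.card = 2) :
    volume (D.hull (D.pieceNodes σ e)) = 0 := by
  classical
  refine measure_mono_null (convexHull_subset_affineSpan _)
    (Measure.addHaar_affineSubspace volume _ fun htop => ?_)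
  obtain ⟨k, hk⟩ : ∃ k, d = k + 1 := ⟨d - 1, by omega⟩
  have h := finrank_vectorSpan_image_finset_le ℝ D.nodePos (D.pieceNodes σ e)
    (n := k) (by rw [card_pieceNodes hd he, hk])
  rw [← direction_affineSpan, Finset.coe_image, htop, AffineSubspace.direction_top, finrank_top,
    finrank_euclideanSpace_fin] at h
  omega

lemma volume_frontier_cell (hd : d = 2 ∨ d = 3) (hD : D.IsMesh Ω) (κ : M) :
    volume (frontier (D.cell κ)) = 0 := by
  rw [hD.cell_frontier]
  refine (measure_biUnion_null_iff (D.cellFaces κ).countable_toSet).2 fun σ _ => ?_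
  refine (measure_biUnion_null_iff (D.faceEdges σ).countable_toSet).2 fun e he => ?_
  exact volume_hull_pieceNodes hd (hD.edge_card σ e he)

/-- The simplices cover the cell, and frontiers of convex sets are null. -/
lemma ae_mem_interior_hull (hd : d = 2 ∨ d = 3) (hD : D.IsMesh Ω) (hΩ : Bornology.IsBounded Ω)
    (κ : M) : ∀ᵐ x ∂(volume.restrict (D.cell κ)),
      ∃ T ∈ D.submesh, T.1 = κ ∧ x ∈ interior (D.hull (D.simplexNodes T)) := by
  have hfr : ∀ᵐ x ∂(volume : Measure (Space d)), ∀ T : M × F × Finset V,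
      x ∉ frontier (D.hull (D.simplexNodes T)) :=
    ae_all_iff.2 fun T => measure_eq_zero_iff_ae_notMem.1 ((convex_hull _).addHaar_frontier volume)
  filter_upwards [ae_restrict_mem (hD.cell_open κ).measurableSet, ae_restrict_of_ae hfr] with x hx h
  obtain ⟨T, hT, hTκ, hxT⟩ := hD.exists_mem_hull_of_mem_closure hd hΩ (subset_closure hx)
  refine ⟨T, hT, hTκ, ?_⟩
  by_contra hni
  exact h T ⟨subset_closure hxT, hni⟩

end IsMesh

end MeshData

namespace MeshData

variable {d : ℕ} {M F V : Type*} [Fintype M] [Fintype F] [Fintype V]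
  [DecidableEq M] [DecidableEq F] [DecidableEq V] {D : MeshData d M F V} {Ω : Set (Space d)}
  {L : Space d → Space d →L[ℝ] Space d}

/-! ### The local matrices are positive definite -/

lemma measurable_gradT (v : W M V) : Measurable (D.gradT v) :=
  (InnerProductSpace.toDual ℝ (Space d)).symm.continuous.measurable.comp
    (measurable_fderiv ℝ (D.recon v))

namespace IsMesh

/-- Almost everywhere the gradient takes one of finitely many values, one per simplex. -/
lemma exists_norm_gradT_le (hd : d = 2 ∨ d = 3) (hD : D.IsMesh Ω) (hΩ : Bornology.IsBounded Ω)
    (κ : M) (v : W M V) : ∃ C, ∀ᵐ x ∂(volume.restrict (D.cell κ)), ‖D.gradT v x‖ ≤ C := by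
  classical
  have h : ∀ T : M × F × Finset V, ∃ g : Space d, T ∈ D.submesh →
      ∀ x ∈ interior (D.hull (D.simplexNodes T)), D.gradT v x = g := by
    intro T
    by_cases hT : T ∈ D.submesh
    · obtain ⟨g, -, -, hg⟩ := hD.exists_gradT_eq hd hT v
      exact ⟨g, fun _ => hg⟩
    · exact ⟨0, fun h => absurd h hT⟩
  choose g hg using h
  refine ⟨∑ T, ‖g T‖, ?_⟩
  filter_upwards [hD.ae_mem_interior_hull hd hΩ κ] with x hxT
  obtain ⟨T, hT, -, hx⟩ := hxT
  rw [hg T hT x hx]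
  exact Finset.single_le_sum (f := fun T => ‖g T‖) (fun _ _ => norm_nonneg _) (Finset.mem_univ T)

lemma integrableOn_inner_gradT (hd : d = 2 ∨ d = 3) (hD : D.IsMesh Ω)
    (hΩ : Bornology.IsBounded Ω) (hL : IsPermeability Ω L) (κ : M) (v v' : W M V) :
    IntegrableOn (fun x => inner ℝ (L x (D.gradT v x)) (D.gradT v' x)) (D.cell κ) := by
  obtain ⟨C, hC⟩ := hD.exists_norm_gradT_le hd hΩ κ v
  obtain ⟨C', hC'⟩ := hD.exists_norm_gradT_le hd hΩ κ v'
  obtain ⟨lmin, lmax, hmin, hle, hell⟩ := hL.elliptic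
  have : IsFiniteMeasure (volume.restrict (D.cell κ)) :=
    isFiniteMeasure_restrict.2 (hD.cell_bounded hΩ κ).measure_lt_top.ne
  have hsub : volume.restrict (D.cell κ) ≤ volume.restrict Ω :=
    Measure.restrict_mono (hD.cell_subset κ) le_rfl
  refine Integrable.of_bound ?_ (lmax * (C ^ 2 + C' ^ 2) / 2) ?_
  · have h1 : AEStronglyMeasurable (fun x => L x (D.gradT v x)) (volume.restrict (D.cell κ)) :=
      (ContinuousLinearMap.id ℝ (Space d →L[ℝ] Space d)).aestronglyMeasurable_comp₂
        (hL.measurable.mono_measure hsub) (measurable_gradT v).aestronglyMeasurable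
    exact h1.inner (measurable_gradT v').aestronglyMeasurable
  · filter_upwards [hC, hC', ae_mono hsub hell, ae_mono hsub hL.symm] with x h h' he hs
    set a := D.gradT v x
    set b := D.gradT v' x
    -- Ellipticity bounds only the quadratic form. Polarization with a + b and a - b, then the
    -- parallelogram law, bounds the bilinear one; this is where the constant comes from.
    have e1 := he (a + b)
    have e2 := he (a - b)
    have hpar := parallelogram_law_with_norm ℝ a b
    have hab : inner ℝ (L x b) a = inner ℝ (L x a) b := by rw [hs, real_inner_comm]
    simp only [map_add, map_sub, inner_add_left, inner_add_right, inner_sub_left,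
      inner_sub_right, hab] at e1 e2
    have h3 : ‖a‖ ^ 2 ≤ C ^ 2 := by gcongr
    have h4 : ‖b‖ ^ 2 ≤ C' ^ 2 := by gcongr
    have hp1 : 0 ≤ lmin * ‖a + b‖ ^ 2 := by positivity
    have hp2 : 0 ≤ lmin * ‖a - b‖ ^ 2 := by positivity
    have hl : 0 < lmax := hmin.trans_le hle
    have h5 : lmax * (‖a + b‖ ^ 2 + ‖a - b‖ ^ 2) ≤ lmax * (2 * (C ^ 2 + C' ^ 2)) :=
      mul_le_mul_of_nonneg_left (by nlinarith) hl.le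
    have h6 : 0 ≤ lmax * ‖a - b‖ ^ 2 := by positivity
    have h7 : 0 ≤ lmax * ‖a + b‖ ^ 2 := by positivity
    rw [Real.norm_eq_abs, abs_le]
    constructor <;> linarith [e1.1, e1.2, e2.1, e2.2]

lemma dotProduct_matA_mulVec (hd : d = 2 ∨ d = 3) (hD : D.IsMesh Ω)
    (hΩ : Bornology.IsBounded Ω) (hL : IsPermeability Ω L) (κ : M)
    (w : {s // s ∈ D.cellVerts κ} → ℝ) :
    IntegrableOn (fun x => inner ℝ (L x (∑ s, w s • D.gradT (basisVertex s.1) x))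
        (∑ s, w s • D.gradT (basisVertex s.1) x)) (D.cell κ) ∧
    w ⬝ᵥ (D.matA L κ *ᵥ w) = ∫ x in D.cell κ,
      inner ℝ (L x (∑ s, w s • D.gradT (basisVertex s.1) x))
        (∑ s, w s • D.gradT (basisVertex s.1) x) := by
  have hi := hD.integrableOn_inner_gradT hd hΩ hL κ
  have hexp : (fun x => inner ℝ (L x (∑ s, w s • D.gradT (basisVertex s.1) x))
        (∑ s, w s • D.gradT (basisVertex s.1) x)) = fun x =>
      ∑ s, ∑ s', w s * (w s' *
        inner ℝ (L x (D.gradT (basisVertex s.1) x)) (D.gradT (basisVertex s'.1) x)) := by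
    funext x
    simp only [map_sum, map_smul, sum_inner, inner_sum, real_inner_smul_left,
      real_inner_smul_right]
    rw [Finset.sum_comm]
    exact Finset.sum_congr rfl fun s _ => Finset.sum_congr rfl fun s' _ => by ring
  have hterm : ∀ s s' : {s // s ∈ D.cellVerts κ}, IntegrableOn (fun x => w s * (w s' *
      inner ℝ (L x (D.gradT (basisVertex s.1) x)) (D.gradT (basisVertex s'.1) x))) (D.cell κ) :=
    fun s s' => ((hi _ _).const_mul _).const_mul _
  rw [hexp]
  refine ⟨integrable_finsetSum _ fun s _ => integrable_finsetSum _ fun s' _ => hterm s s', ?_⟩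
  rw [integral_finsetSum _ fun s _ => integrable_finsetSum _ fun s' _ => hterm s s']
  simp_rw [integral_finsetSum _ fun s' _ => hterm _ s', integral_const_mul]
  simp only [dotProduct, Matrix.mulVec, matA, Matrix.of_apply, Finset.mul_sum]
  exact Finset.sum_congr rfl fun s _ => Finset.sum_congr rfl fun s' _ => by ring

/-- If the form vanishes, ellipticity makes the gradient of the reconstruction with vertex values w
and cell value 0 vanish a.e. in the cell. That function is then constant on a simplex joining the
cell center to a given vertex: its value is 0 at the center and w_s at the vertex. -/
lemma matA_pos (hd : d = 2 ∨ d = 3) (hD : D.IsMesh Ω) (hΩ : Bornology.IsBounded Ω)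
    (hL : IsPermeability Ω L) (κ : M) {w : {s // s ∈ D.cellVerts κ} → ℝ} (hw : w ≠ 0) :
    0 < w ⬝ᵥ (D.matA L κ *ᵥ w) := by
  obtain ⟨hintg, heq⟩ := hD.dotProduct_matA_mulVec hd hΩ hL κ w
  rw [heq]
  set G : Space d → Space d := fun x => ∑ s, w s • D.gradT (basisVertex s.1) x with hG
  obtain ⟨lmin, lmax, hmin, -, hell⟩ := hL.elliptic
  have hsub : volume.restrict (D.cell κ) ≤ volume.restrict Ω :=
    Measure.restrict_mono (hD.cell_subset κ) le_rfl
  have hlow : ∀ᵐ x ∂(volume.restrict (D.cell κ)),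
      lmin * ‖G x‖ ^ 2 ≤ inner ℝ (L x (G x)) (G x) := by
    filter_upwards [ae_mono hsub hell] with x hx using (hx _).1
  have hnn : 0 ≤ᵐ[volume.restrict (D.cell κ)] fun x => inner ℝ (L x (G x)) (G x) := by
    filter_upwards [hlow] with x hx
    exact le_trans (by positivity) hx
  refine lt_of_le_of_ne (integral_nonneg_of_ae hnn) fun h0 => hw ?_
  have hzero := (setIntegral_eq_zero_iff_of_nonneg_ae hnn hintg).1 h0.symm
  have hGz : ∀ᵐ x ∂(volume.restrict (D.cell κ)), G x = 0 := by
    filter_upwards [hlow, hzero] with x h1 h2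
    rw [h2] at h1
    have h3 : ‖G x‖ ^ 2 ≤ 0 := by
      by_contra! h
      have := mul_pos hmin h
      simp only [Pi.zero_apply] at h1
      linarith
    simpa using le_antisymm h3 (by positivity)
  funext s₀
  obtain ⟨σ, hσ, hsσ⟩ := Finset.mem_biUnion.1 s₀.2
  rw [hD.face_verts] at hsσ
  obtain ⟨e, he, hse⟩ := Finset.mem_biUnion.1 hsσ
  have hse : s₀.1 ∈ e := hse
  have hT : (κ, σ, e) ∈ D.submesh := ⟨hσ, he⟩
  choose g c hgc hgrad using fun s : {s // s ∈ D.cellVerts κ} =>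
    hD.exists_gradT_eq hd hT (basisVertex (M := M) s.1)
  set U := interior (D.hull (D.simplexNodes (κ, σ, e))) ∩ D.cell κ with hU
  have hUo : IsOpen U := isOpen_interior.inter (hD.cell_open κ)
  -- The center belongs to the open cell and to the closure of the interior of the simplex.
  have hUne : U.Nonempty := by
    have h1 : D.cellCenter κ ∈ closure (interior (D.hull (D.simplexNodes (κ, σ, e)))) := by
      rw [(convex_hull _).closure_interior_eq_closure_of_nonempty_interior
        (hD.interior_hull_nonempty hd hT)]
      exact subset_closure (nodePos_mem_hull (n := Sum.inl κ)
        (cell_mem_simplexNodes (κ, σ, e)))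
    rw [hU, inter_comm]
    exact mem_closure_iff.1 h1 _ (hD.cell_open κ) (hD.center_mem κ)
  obtain ⟨x, hxU, hx⟩ : ∃ x ∈ U, G x = 0 := by
    by_contra! hno
    have h1 : volume U = 0 := by
      have h2 := ae_restrict_of_ae_restrict_of_subset (hU ▸ inter_subset_right : U ⊆ D.cell κ) hGz
      have h3 : ∀ᵐ x ∂(volume.restrict U), False := by
        filter_upwards [h2, ae_restrict_mem hUo.measurableSet] with y hy hyU using hno y hyU hy
      rwa [eventually_false_iff_eq_bot, ae_eq_bot, Measure.restrict_eq_zero] at h3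
    exact hUne.ne_empty ((hUo.measure_eq_zero_iff volume).1 h1)
  have hsum : ∑ s, w s • g s = 0 := by
    rw [← hx, hG]
    exact Finset.sum_congr rfl fun s _ => by rw [hgrad s x hxU.1]
  have hval : ∀ n ∈ D.simplexNodes (κ, σ, e),
      ∑ s, w s * D.nodeVal (basisVertex s.1) n = ∑ s, w s * c s := by
    intro n hn
    have h1 : inner ℝ (∑ s, w s • g s) (D.nodePos n) = (0 : ℝ) := by rw [hsum, inner_zero_left]
    rw [sum_inner] at h1
    simp_rw [real_inner_smul_left] at h1
    simp_rw [← hgc _ n hn, mul_add]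
    rw [Finset.sum_add_distrib, h1, zero_add]
  have hv1 := hval _ (cell_mem_simplexNodes (κ, σ, e))
  have hv2 := hval _ (vertex_mem_simplexNodes (T := (κ, σ, e)) hse)
  rw [← hv1] at hv2
  simp only [nodeVal, basisVertex, ne_eq, reduceCtorEq, not_false_eq_true, Pi.single_eq_of_ne,
    mul_zero, Finset.sum_const_zero] at hv2
  rw [Finset.sum_eq_single s₀] at hv2
  · simpa using hv2
  · intro s _ hs
    rw [Pi.single_eq_of_ne, mul_zero]
    exact fun h => hs (Subtype.ext (Sum.inr_injective h).symm)
  · exact fun h => absurd (Finset.mem_univ _) h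

lemma matA_nonneg (hd : d = 2 ∨ d = 3) (hD : D.IsMesh Ω) (hΩ : Bornology.IsBounded Ω)
    (hL : IsPermeability Ω L) (κ : M) (w : {s // s ∈ D.cellVerts κ} → ℝ) :
    0 ≤ w ⬝ᵥ (D.matA L κ *ᵥ w) := by
  by_cases hw : w = 0
  · simp [hw]
  · exact (hD.matA_pos hd hΩ hL κ hw).le

end IsMesh

end MeshData

/-- The form has a positive minimum on the compact unit sphere, and it is homogeneous of degree 2.
-/
lemma exists_coercivity_constant {ι : Type*} [Fintype ι] (A : Matrix ι ι ℝ)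
    (hA : ∀ w : ι → ℝ, w ≠ 0 → 0 < w ⬝ᵥ (A *ᵥ w)) :
    ∃ c > 0, ∀ (w : ι → ℝ) (i : ι), c * w i ^ 2 ≤ w ⬝ᵥ (A *ᵥ w) := by
  have hcont : Continuous fun w : ι → ℝ => w ⬝ᵥ (A *ᵥ w) := by
    simp only [dotProduct, Matrix.mulVec]; fun_prop
  obtain ⟨c, hc, hmin⟩ : ∃ c > 0, ∀ w ∈ Metric.sphere (0 : ι → ℝ) 1, c ≤ w ⬝ᵥ (A *ᵥ w) := by
    -- The sphere is empty when `ι` is.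
    rcases (Metric.sphere (0 : ι → ℝ) 1).eq_empty_or_nonempty with h | h
    · exact ⟨1, one_pos, by simp [h]⟩
    · obtain ⟨w₀, hw₀, hm⟩ := (isCompact_sphere (0 : ι → ℝ) 1).exists_isMinOn h hcont.continuousOn
      exact ⟨_, hA w₀ (ne_zero_of_mem_unit_sphere ⟨w₀, hw₀⟩), fun w hw => hm hw⟩
  refine ⟨c, hc, fun w i => ?_⟩
  by_cases hw : w = 0
  · simp [hw]
  have hn : 0 < ‖w‖ := norm_pos_iff.2 hw
  have h1 := hmin (‖w‖⁻¹ • w) (by simp [norm_smul, hn.ne'])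
  rw [Matrix.mulVec_smul, smul_dotProduct, dotProduct_smul, smul_eq_mul, smul_eq_mul] at h1
  have h2 : c * ‖w‖ ^ 2 ≤ w ⬝ᵥ (A *ᵥ w) := by
    calc c * ‖w‖ ^ 2 ≤ (‖w‖⁻¹ * (‖w‖⁻¹ * w ⬝ᵥ (A *ᵥ w))) * ‖w‖ ^ 2 := by gcongr
      _ = w ⬝ᵥ (A *ᵥ w) := by field_simp
  refine le_trans (mul_le_mul_of_nonneg_left ?_ hc.le) h2
  rw [← sq_abs (w i)]
  have := norm_le_pi_norm w i
  rw [Real.norm_eq_abs] at this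
  gcongr

namespace Lumping

variable {d : ℕ} {M F V : Type*} [Fintype M] [Fintype F] [Fintype V]
  [DecidableEq M] [DecidableEq F] [DecidableEq V] {D : MeshData d M F V} {Ω : Set (Space d)}
  {P : Lumping d M V}

/-! ### Integrals of piecewise constant reconstructions -/

/-- The sets `ω_β`. -/
def omega (P : Lumping d M V) (D : MeshData d M F V) : M ⊕ V → Set (Space d) :=
  Sum.elim P.omegaCell (P.omegaVertex D)

lemma mem_omegaVertex {s : V} {x : Space d} :
    x ∈ P.omegaVertex D s ↔ ∃ κ, s ∈ D.cellVerts κ ∧ x ∈ P.omegaCV κ s := by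
  simp [omegaVertex, MeshData.vertexCells]

namespace IsLumping

lemma isOpen_omega (hP : P.IsLumping D) (b : M ⊕ V) : IsOpen (P.omega D b) := by
  rcases b with κ | s
  · exact hP.omegaCell_open κ
  · refine isOpen_biUnion fun κ hκ => hP.omegaCV_open κ s ?_
    simpa [MeshData.vertexCells] using hκ

lemma exists_of_mem_omega (hP : P.IsLumping D) {b : M ⊕ V} {x : Space d} (hx : x ∈ P.omega D b) :
    ∃ κ, x ∈ D.cell κ ∧ ((b = Sum.inl κ ∧ x ∈ P.omegaCell κ) ∨
      ∃ s ∈ D.cellVerts κ, b = Sum.inr s ∧ x ∈ P.omegaCV κ s) := by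
  rcases b with κ | s
  · exact ⟨κ, hP.omegaCell_subset κ hx, Or.inl ⟨rfl, hx⟩⟩
  · obtain ⟨κ, hs, hxκ⟩ := mem_omegaVertex.1 hx
    exact ⟨κ, hP.omegaCV_subset κ s hs hxκ, Or.inr ⟨s, hs, rfl, hxκ⟩⟩

lemma pairwise_disjoint_omega (hP : P.IsLumping D) (hD : D.IsMesh Ω) :
    Pairwise fun b b' => Disjoint (P.omega D b) (P.omega D b') := by
  intro b b' hne
  rw [Set.disjoint_left]
  intro x hx hx'
  obtain ⟨κ, hκ, h⟩ := hP.exists_of_mem_omega hx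
  obtain ⟨κ', hκ', h'⟩ := hP.exists_of_mem_omega hx'
  obtain rfl : κ = κ' := by
    by_contra hcon
    exact Set.disjoint_left.1 (hD.cell_disjoint hcon) hκ hκ'
  rcases h with ⟨rfl, h⟩ | ⟨s, hs, rfl, h⟩ <;> rcases h' with ⟨rfl, h'⟩ | ⟨s', hs', rfl, h'⟩
  · exact hne rfl
  · exact Set.disjoint_left.1 (hP.disjoint_cell κ s' hs') h h'
  · exact Set.disjoint_left.1 (hP.disjoint_cell κ s hs) h' h
  · exact Set.disjoint_left.1 (hP.disjoint_cv κ s hs s' hs' fun h => hne (by rw [h])) h h'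

lemma omega_subset (hP : P.IsLumping D) (hD : D.IsMesh Ω) (b : M ⊕ V) : P.omega D b ⊆ Ω := by
  intro x hx
  obtain ⟨κ, hκ, -⟩ := hP.exists_of_mem_omega hx
  exact hD.cell_subset κ hκ

lemma volume_real_omega (hP : P.IsLumping D) (hD : D.IsMesh Ω) (hΩ : Bornology.IsBounded Ω)
    (b : M ⊕ V) : volume.real (P.omega D b) = P.mass D b := by
  rcases b with κ | s
  · exact hP.meas_cell κ
  · have hmem : ∀ κ ∈ D.vertexCells s, s ∈ D.cellVerts κ := fun κ hκ => by
      simpa [MeshData.vertexCells] using hκ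
    change volume.real (⋃ κ ∈ D.vertexCells s, P.omegaCV κ s)
      = ∑ κ ∈ D.vertexCells s, P.massCV D κ s
    rw [measureReal_biUnion_finset (h := fun κ hκ => ((hD.cell_bounded hΩ κ).subset
        (hP.omegaCV_subset κ s (hmem κ hκ))).measure_lt_top.ne)]
    · exact Finset.sum_congr rfl fun κ hκ => hP.meas_cv κ s (hmem κ hκ)
    · intro κ hκ κ' hκ' hne
      exact (hD.cell_disjoint hne).mono (hP.omegaCV_subset κ s (hmem κ hκ))
        (hP.omegaCV_subset κ' s (hmem κ' hκ'))
    · exact fun κ hκ => (hP.omegaCV_open κ s (hmem κ hκ)).measurableSet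

/-- The pieces are disjoint and, by the definition of m_κ, their measures add up to that of the
cell. -/
lemma volume_cell_diff (hP : P.IsLumping D) (hD : D.IsMesh Ω) (hΩ : Bornology.IsBounded Ω)
    (κ : M) : volume (D.cell κ \ ⋃ b, P.omega D b) = 0 := by
  set S := P.omegaCell κ ∪ ⋃ s ∈ D.cellVerts κ, P.omegaCV κ s with hS
  have hSκ : S ⊆ D.cell κ :=
    union_subset (hP.omegaCell_subset κ) (iUnion₂_subset fun s hs => hP.omegaCV_subset κ s hs)
  have hUo : IsOpen (⋃ s ∈ D.cellVerts κ, P.omegaCV κ s) :=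
    isOpen_biUnion fun s hs => hP.omegaCV_open κ s hs
  have hSo : IsOpen S := (hP.omegaCell_open κ).union hUo
  have hfin : ∀ A ⊆ D.cell κ, volume A ≠ ∞ := fun A hA =>
    ((hD.cell_bounded hΩ κ).subset hA).measure_lt_top.ne
  have hreal : volume.real S = volume.real (D.cell κ) := by
    rw [hS, measureReal_union _ hUo.measurableSet (hfin _ (hP.omegaCell_subset κ))
      (hfin _ (subset_union_right.trans hSκ)), hP.meas_cell κ, measureReal_biUnion_finset
      (h := fun s hs => hfin _ (hP.omegaCV_subset κ s hs))]
    · rw [Finset.sum_congr rfl fun s hs => hP.meas_cv κ s hs]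
      simp [mass]
    · intro s hs s' hs' hne
      exact hP.disjoint_cv κ s hs s' hs' hne
    · exact fun s hs => (hP.omegaCV_open κ s hs).measurableSet
    · simp only [disjoint_iUnion_right]
      exact fun s hs => hP.disjoint_cell κ s hs
  have hdiff : volume (D.cell κ \ S) = 0 := by
    have h := measureReal_sdiff (μ := volume) hSκ hSo.measurableSet (hfin _ subset_rfl)
    rw [hreal, sub_self] at h
    exact (measureReal_eq_zero_iff (hfin _ sdiff_subset)).1 h
  refine measure_mono_null (sdiff_subset_sdiff_right ?_) hdiff
  refine union_subset (subset_iUnion_of_subset (Sum.inl κ) subset_rfl)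
    (iUnion₂_subset fun s hs => subset_iUnion_of_subset (Sum.inr s) fun x hx => ?_)
  exact mem_omegaVertex.2 ⟨κ, hs, hx⟩

lemma iUnion_omega_ae_eq (hP : P.IsLumping D) (hd : d = 2 ∨ d = 3) (hD : D.IsMesh Ω)
    (hΩ : Bornology.IsBounded Ω) : (⋃ b, P.omega D b) =ᵐ[volume] Ω := by
  refine (iUnion_subset (hP.omega_subset hD)).eventuallyLE.antisymm
    (ae_le_set.2 (measure_mono_null (t := ⋃ κ, (D.cell κ \ ⋃ b, P.omega D b) ∪
      frontier (D.cell κ)) ?_ ?_))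
  · rintro x ⟨hx, hxo⟩
    have : x ∈ ⋃ κ, closure (D.cell κ) := hD.cell_cover ▸ subset_closure hx
    obtain ⟨κ, hκ⟩ := mem_iUnion.1 this
    rw [closure_eq_self_union_frontier] at hκ
    exact mem_iUnion.2 ⟨κ, hκ.imp (fun h => ⟨h, hxo⟩) id⟩
  · exact measure_iUnion_null fun κ =>
      measure_union_null (hP.volume_cell_diff hD hΩ κ) (hD.volume_frontier_cell hd κ)

lemma reconD_eq (hP : P.IsLumping D) (hD : D.IsMesh Ω) (v : W M V) {b : M ⊕ V} {x : Space d}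
    (hx : x ∈ P.omega D b) : P.reconD D v x = v b := by
  have h : P.reconD D v x = ∑ b, (P.omega D b).indicator (fun _ => v b) x := by
    rw [Fintype.sum_sum_type]; rfl
  rw [h, Finset.sum_eq_single b]
  · exact indicator_of_mem hx _
  · intro b' _ hb'
    exact indicator_of_notMem
      (fun hx' => Set.disjoint_left.1 (hP.pairwise_disjoint_omega hD hb') hx' hx) _
  · exact fun h => absurd (Finset.mem_univ _) h

lemma volume_omega (hP : P.IsLumping D) (hD : D.IsMesh Ω) (hΩ : Bornology.IsBounded Ω)
    (b : M ⊕ V) : volume (P.omega D b) = ENNReal.ofReal (P.mass D b) := by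
  rw [← hP.volume_real_omega hD hΩ, ofReal_measureReal
    (hΩ.subset (hP.omega_subset hD b)).measure_lt_top.ne]

lemma lintegral_reconD (hP : P.IsLumping D) (hd : d = 2 ∨ d = 3) (hD : D.IsMesh Ω)
    (hΩ : Bornology.IsBounded Ω) (f : ℝ → ℝ≥0∞) (v : W M V) :
    ∫⁻ x in Ω, f (P.reconD D v x) = ∑ b, ENNReal.ofReal (P.mass D b) * f (v b) := by
  rw [← setLIntegral_congr (hP.iUnion_omega_ae_eq hd hD hΩ),
    lintegral_iUnion (fun b => (hP.isOpen_omega b).measurableSet)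
      (hP.pairwise_disjoint_omega hD), tsum_fintype]
  refine Finset.sum_congr rfl fun b _ => ?_
  rw [setLIntegral_congr_fun (g := fun _ => f (v b)) (hP.isOpen_omega b).measurableSet
    fun x hx => by simp only [hP.reconD_eq hD v hx], setLIntegral_const, hP.volume_omega hD hΩ,
    mul_comm]

lemma integral_reconD (hP : P.IsLumping D) (hd : d = 2 ∨ d = 3) (hD : D.IsMesh Ω)
    (hΩ : Bornology.IsBounded Ω) (f : ℝ → ℝ → ℝ) (v v' : W M V) :
    ∫ x in Ω, f (P.reconD D v x) (P.reconD D v' x) = ∑ b, P.mass D b * f (v b) (v' b) := by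
  have hcongr : ∀ b, EqOn (fun x => f (P.reconD D v x) (P.reconD D v' x))
      (fun _ => f (v b) (v' b)) (P.omega D b) := fun b x hx => by
    simp only [hP.reconD_eq hD v hx, hP.reconD_eq hD v' hx]
  rw [← setIntegral_congr_set (hP.iUnion_omega_ae_eq hd hD hΩ),
    integral_iUnion_fintype (fun b => (hP.isOpen_omega b).measurableSet)
      (hP.pairwise_disjoint_omega hD)]
  · refine Finset.sum_congr rfl fun b _ => ?_
    rw [setIntegral_congr_fun (hP.isOpen_omega b).measurableSet (hcongr b), setIntegral_const,
      hP.volume_real_omega hD hΩ, smul_eq_mul]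
  · intro b
    refine (integrableOn_const ?_).congr_fun (hcongr b).symm (hP.isOpen_omega b).measurableSet
    exact (hΩ.subset (hP.omega_subset hD b)).measure_lt_top.ne

/-- On the closure of I_p the entropy function is finite and nonnegative, so the extended-real
entropy reduces to a finite real sum. -/
lemma entropyD_eq (hP : P.IsLumping D) (hd : d = 2 ∨ d = 3) (hD : D.IsMesh Ω)
    (hΩ : Bornology.IsBounded Ω) (hm : ∀ b, 0 < P.mass D b) {η p : ℝ → ℝ} (hp : IsPressure η p)
    (Vext : Space d → ℝ) {v : W M V} (hv : ∀ b, v b ∈ closure (Ip p)) :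
    P.entropyD D Ω p Vext v = ((∑ b, P.mass D b * (entropyReal p (v b)
      + v b * D.potential Vext b) : ℝ) : EReal) := by
  rw [entropyD, hP.lintegral_reconD hd hD hΩ,
    hP.integral_reconD hd hD hΩ (fun a b => a * b)]
  have h : ∑ b, ENNReal.ofReal (P.mass D b) * Gam p (v b)
      = ENNReal.ofReal (∑ b, P.mass D b * entropyReal p (v b)) := by
    rw [ENNReal.ofReal_sum_of_nonneg fun b _ =>
      mul_nonneg (hm b).le (hp.entropyReal_nonneg (hv b))]
    refine Finset.sum_congr rfl fun b _ => ?_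
    rw [Gam, if_pos (hv b), ENNReal.ofReal_mul (hm b).le]
  have hnn : 0 ≤ ∑ b, P.mass D b * entropyReal p (v b) :=
    Finset.sum_nonneg fun b _ => mul_nonneg (hm b).le (hp.entropyReal_nonneg (hv b))
  rw [h, EReal.coe_ennreal_ofReal, max_eq_left hnn, ← EReal.coe_add, ← Finset.sum_add_distrib]
  simp_rw [← mul_add]

/-- Every ω_β has positive measure, so a single value outside the closure makes the first integral
infinite, and the real second term cannot compensate. -/
lemma mem_closure_of_finiteEntropy (hP : P.IsLumping D) (hd : d = 2 ∨ d = 3) (hD : D.IsMesh Ω)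
    (hΩ : Bornology.IsBounded Ω) (hm : ∀ b, 0 < P.mass D b) {p : ℝ → ℝ}
    {Vext : Space d → ℝ} {v : W M V} (hv : v ∈ P.FiniteEntropy D Ω p Vext) (b : M ⊕ V) :
    v b ∈ closure (Ip p) := by
  by_contra hb
  have hv : P.entropyD D Ω p Vext v < ⊤ := hv
  have htop : ∑ b, ENNReal.ofReal (P.mass D b) * Gam p (v b) = ⊤ := by
    refine ENNReal.sum_eq_top.2 ⟨b, Finset.mem_univ _, ?_⟩
    rw [Gam, if_neg hb, ENNReal.mul_top (by simpa using hm b)]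
  rw [entropyD, hP.lintegral_reconD hd hD hΩ, htop, EReal.coe_ennreal_top,
    EReal.top_add_coe] at hv
  exact lt_irrefl _ hv

end IsLumping

end Lumping

variable {d : ℕ} {M F V : Type*} [Fintype M] [Fintype F] [Fintype V]
  [DecidableEq M] [DecidableEq F] [DecidableEq V] {D : MeshData d M F V} {Ω : Set (Space d)}
  {P : Lumping d M V} {L : Space d → Space d →L[ℝ] Space d} {η p q : ℝ → ℝ}
  {Vext : Space d → ℝ} {dt : ℝ} {uOld u : W M V}

/-! ### The energy identity -/

/-- The dissipation `δ_κ h · B_κ(u) δ_κ h` in a cell. -/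
noncomputable def dissipation (D : MeshData d M F V) (L : Space d → Space d →L[ℝ] Space d) (η : ℝ → ℝ)
    (u h : W M V) (κ : M) : ℝ := D.del κ h ⬝ᵥ (D.matB L η κ u *ᵥ D.del κ h)

/-- The diagonal factors move onto the vector, so positivity of A_κ transfers to the dissipation. -/
lemma dissipation_eq (u h : W M V) (κ : M) :
    dissipation D L η u h κ
      = (fun s => √(MeshData.etaAvg η u κ s.1) * D.del κ h s) ⬝ᵥ
        (D.matA L κ *ᵥ fun s => √(MeshData.etaAvg η u κ s.1) * D.del κ h s) := by
  simp only [dissipation, MeshData.matB, MeshData.matM, dotProduct, Matrix.mulVec,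
    Matrix.mul_diagonal, Matrix.diagonal_mul, Finset.mul_sum]
  exact Finset.sum_congr rfl fun s _ => Finset.sum_congr rfl fun s' _ => by ring

lemma sum_fluxCV_mul_del (u : W M V) (κ : M) :
    ∑ s, D.fluxCV L η p Vext u κ s * D.del κ (D.hydro p Vext u) s
      = dissipation D L η u (D.hydro p Vext u) κ := by
  simp only [dissipation, MeshData.matB, MeshData.matM, dotProduct, Matrix.mulVec,
    Matrix.mul_diagonal, Matrix.diagonal_mul, MeshData.fluxCV, Finset.mul_sum, Finset.sum_mul,
    MeshData.del]
  exact Finset.sum_congr rfl fun s _ => Finset.sum_congr rfl fun s' _ => by ring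

/-- The left-hand side of the scheme. -/
noncomputable def residual (P : Lumping d M V) (D : MeshData d M F V) (L : Space d → Space d →L[ℝ] Space d)
    (η p : ℝ → ℝ) (Vext : Space d → ℝ) (dt : ℝ) (uOld u : W M V) : W M V :=
  Sum.elim
    (fun κ => P.mass D (Sum.inl κ) * ((u (Sum.inl κ) - uOld (Sum.inl κ)) / dt)
      + ∑ s : {s // s ∈ D.cellVerts κ}, D.fluxCV L η p Vext u κ s)
    (fun s => P.mass D (Sum.inr s) * ((u (Sum.inr s) - uOld (Sum.inr s)) / dt)
      + ∑ κ : {κ // s ∈ D.cellVerts κ}, D.fluxVC L η p Vext u κ.1 ⟨s, κ.2⟩)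

lemma solvesScheme_iff :
    P.SolvesScheme D L η p Vext dt uOld u ↔ residual P D L η p Vext dt uOld u = 0 := by
  rw [funext_iff, Sum.forall]
  rfl

/-- Discrete integration by parts: antisymmetry of the fluxes and an exchange of the sums over cells
and vertices. -/
lemma sum_residual_mul (φ : W M V) :
    ∑ b, residual P D L η p Vext dt uOld u b * φ b
      = ∑ b, P.mass D b * ((u b - uOld b) / dt) * φ b
        + ∑ κ, ∑ s, D.fluxCV L η p Vext u κ s * D.del κ φ s := by
  have hswap : ∑ s : V, ∑ κ : {κ // s ∈ D.cellVerts κ},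
      D.fluxCV L η p Vext u κ.1 ⟨s, κ.2⟩ * φ (Sum.inr s)
        = ∑ κ : M, ∑ s : {s // s ∈ D.cellVerts κ},
          D.fluxCV L η p Vext u κ s * φ (Sum.inr s.1) := by
    rw [Finset.sum_sigma', Finset.sum_sigma']
    exact Finset.sum_bij' (fun x _ => ⟨x.2.1, x.1, x.2.2⟩) (fun x _ => ⟨x.2.1, x.1, x.2.2⟩)
      (by simp) (by simp) (by simp) (by simp) (by simp)
  simp only [Fintype.sum_sum_type, residual, Sum.elim_inl, Sum.elim_inr, add_mul,
    Finset.sum_add_distrib, Finset.sum_mul, MeshData.fluxVC, neg_mul, Finset.sum_neg_distrib,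
    hswap, MeshData.del, mul_sub, Finset.sum_sub_distrib]
  ring

/-- Conservation of mass: the test vector is constant. -/
lemma sum_mass_mul_sub_eq_zero (hdt : 0 < dt) (h : P.SolvesScheme D L η p Vext dt uOld u) :
    ∑ b, P.mass D b * (u b - uOld b) = 0 := by
  have h1 := sum_residual_mul (P := P) (D := D) (L := L) (η := η) (p := p) (Vext := Vext)
    (dt := dt) (uOld := uOld) (u := u) (fun _ => 1)
  rw [solvesScheme_iff.1 h] at h1
  simp only [Pi.zero_apply, Finset.sum_const_zero, mul_one, MeshData.del, sub_self,
    mul_zero, add_zero, mul_div_assoc', ← Finset.sum_div] at h1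
  rcases div_eq_zero_iff.1 h1.symm with h2 | h2
  · exact h2
  · exact absurd h2 hdt.ne'

/-- The test vector is the hydrostatic pressure. -/
lemma sum_mass_mul_hydro (hdt : 0 < dt) (h : P.SolvesScheme D L η p Vext dt uOld u) :
    ∑ b, P.mass D b * (u b - uOld b) * D.hydro p Vext u b
      + dt * ∑ κ, dissipation D L η u (D.hydro p Vext u) κ = 0 := by
  have h1 := sum_residual_mul (P := P) (D := D) (L := L) (η := η) (p := p) (Vext := Vext)
    (dt := dt) (uOld := uOld) (u := u) (D.hydro p Vext u)
  rw [solvesScheme_iff.1 h] at h1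
  simp only [Pi.zero_apply, zero_mul, Finset.sum_const_zero, sum_fluxCV_mul_del] at h1
  have h2 : dt * ∑ b, P.mass D b * ((u b - uOld b) / dt) * D.hydro p Vext u b
      = ∑ b, P.mass D b * (u b - uOld b) * D.hydro p Vext u b := by
    rw [Finset.mul_sum]
    exact Finset.sum_congr rfl fun b _ => by field_simp
  rw [← h2, ← mul_add, ← h1, mul_zero]

/-- The discrete energy inequality. -/
lemma energy_inequality (hp : IsPressure η p) (hm : ∀ b, 0 < P.mass D b) (hdt : 0 < dt)
    (hOld : ∀ b, uOld b ∈ closure (Ip p)) (hu : u ∈ Admissible M V p)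
    (h : P.SolvesScheme D L η p Vext dt uOld u) :
    ∑ b, P.mass D b * (entropyReal p (u b) + u b * D.potential Vext b)
      + dt * ∑ κ, dissipation D L η u (D.hydro p Vext u) κ
      ≤ ∑ b, P.mass D b * (entropyReal p (uOld b) + uOld b * D.potential Vext b) := by
  -- Tangent inequality for the entropy at each index; the slope is p(u) - p(1), and the p(1) part
  -- is removed by conservation of mass.
  have h1 : ∑ b, P.mass D b * (entropyReal p (u b) + u b * D.potential Vext b)
      - ∑ b, P.mass D b * (entropyReal p (uOld b) + uOld b * D.potential Vext b)
      ≤ ∑ b, P.mass D b * (u b - uOld b) * D.hydro p Vext u b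
        - p 1 * ∑ b, P.mass D b * (u b - uOld b) := by
    rw [Finset.mul_sum, ← Finset.sum_sub_distrib, ← Finset.sum_sub_distrib]
    refine Finset.sum_le_sum fun b _ => ?_
    have := mul_le_mul_of_nonneg_left (hp.entropyReal_sub_le (hu b) (hOld b)) (hm b).le
    simp only [MeshData.hydro]
    linarith
  rw [sum_mass_mul_sub_eq_zero hdt h] at h1
  linarith [sum_mass_mul_hydro hdt h]

/-! ### Existence of a solution -/

/-- The state with hydrostatic pressure `z`. -/
def stateOf (D : MeshData d M F V) (q : ℝ → ℝ) (Vext : Space d → ℝ) (z : W M V) : W M V :=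
  fun b => q (z b - D.potential Vext b)

lemma hydro_stateOf (hq : IsPressureInverse p q) (z : W M V) :
    D.hydro p Vext (stateOf D q Vext z) = z := by
  funext b
  simp [MeshData.hydro, stateOf, hq.right_inv]

/-- In the variable z the hydrostatic pressure is z itself, so p drops out and only continuity of q
and η matters. -/
lemma continuous_residual_stateOf (hη : Continuous η) (hq : IsPressureInverse p q) :
    Continuous fun z => residual P D L η p Vext dt uOld (stateOf D q Vext z) := by
  have hu : ∀ b, Continuous fun z : W M V => stateOf D q Vext z b := fun b =>
    hq.continuous.comp ((continuous_apply b).sub continuous_const)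
  have havg : ∀ κ s, Continuous fun z => √(MeshData.etaAvg η (stateOf D q Vext z) κ s) :=
    fun κ s => (((hη.comp (hu _)).add (hη.comp (hu _))).div_const 2).sqrt
  have hflux : ∀ κ s, Continuous fun z => D.fluxCV L η p Vext (stateOf D q Vext z) κ s := by
    intro κ s
    simp only [MeshData.fluxCV, hydro_stateOf hq]
    exact (havg κ s).mul (continuous_finsetSum _ fun s' _ =>
      (continuous_const.mul (havg κ s')).mul ((continuous_apply _).sub (continuous_apply _)))
  refine continuous_pi fun b => ?_
  rcases b with κ | s
  · exact (continuous_const.mul (((hu _).sub continuous_const).div_const dt)).add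
      (continuous_finsetSum _ fun s _ => hflux κ s)
  · exact (continuous_const.mul (((hu _).sub continuous_const).div_const dt)).add
      (continuous_finsetSum _ fun κ _ => (hflux κ.1 _).neg)

lemma sum_residual_stateOf_mul (hq : IsPressureInverse p q) (z : W M V) :
    ∑ b, residual P D L η p Vext dt uOld (stateOf D q Vext z) b * z b
      = ∑ b, P.mass D b / dt * ((stateOf D q Vext z b - uOld b) * z b)
        + ∑ κ, dissipation D L η (stateOf D q Vext z) z κ := by
  rw [sum_residual_mul]
  congr 1
  · exact Finset.sum_congr rfl fun b _ => by ring
  · refine Finset.sum_congr rfl fun κ _ => ?_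
    have := sum_fluxCV_mul_del (D := D) (L := L) (η := η) (p := p) (Vext := Vext)
      (stateOf D q Vext z) κ
    rwa [hydro_stateOf hq] at this

lemma dissipation_nonneg (hd : d = 2 ∨ d = 3) (hD : D.IsMesh Ω) (hΩ : Bornology.IsBounded Ω)
    (hL : IsPermeability Ω L) (u h : W M V) (κ : M) : 0 ≤ dissipation D L η u h κ := by
  rw [dissipation_eq]
  exact hD.matA_nonneg hd hΩ hL κ _

/-- The dissipation controls the jumps of `h`, weighted by the mobility. -/
lemma exists_mul_etaAvg_le_dissipation (hd : d = 2 ∨ d = 3) (hD : D.IsMesh Ω)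
    (hΩ : Bornology.IsBounded Ω) (hL : IsPermeability Ω L) (hη : ∀ u, 0 ≤ η u) (κ : M) :
    ∃ c > 0, ∀ (u h : W M V), ∀ s ∈ D.cellVerts κ,
      c * (MeshData.etaAvg η u κ s * (h (Sum.inl κ) - h (Sum.inr s)) ^ 2)
        ≤ dissipation D L η u h κ := by
  obtain ⟨c, hc, h⟩ := exists_coercivity_constant (D.matA L κ)
    fun w hw => hD.matA_pos hd hΩ hL κ hw
  refine ⟨c, hc, fun u v s hs => ?_⟩
  have h1 := h (fun s => √(MeshData.etaAvg η u κ s.1) * D.del κ v s) ⟨s, hs⟩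
  rw [← dissipation_eq, mul_pow, Real.sq_sqrt] at h1
  · exact h1
  · exact div_nonneg (add_nonneg (hη _) (hη _)) zero_le_two

lemma IsMobility.nonneg (hη : IsMobility η) (u : ℝ) : 0 ≤ η u := by
  by_cases h : u = 0
  · rw [h, hη.zero]
  · exact (hη.pos u h).le

/-- If `p(0) = -∞`, lower bounds on the pressure propagate between a cell and its vertices as long
as the dissipation is bounded. -/
lemma exists_lower_bound (hs : PressureSingular p) (hη : IsMobility η)
    (hq : IsPressureInverse p q) {c C : ℝ} (hc : 0 < c) (K v : ℝ) :
    ∃ K', ∀ x y e : ℝ, K ≤ x → η (q (x - v)) / 2 ≤ e → c * (e * (x - y) ^ 2) ≤ C → K' ≤ y := by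
  set u₁ := q (K - v) with hu₁
  have hu₁pos : 0 < u₁ := hq.mem _ hs
  have hη₁ : 0 < η u₁ := hη.pos _ hu₁pos.ne'
  -- The fraction bounds (x - y)², and t ≤ t² + 1 turns this into a bound on x - y.
  refine ⟨K - (2 * C / (c * η u₁) + 1), fun x y e hx he hle => ?_⟩
  have h1 : η u₁ ≤ η (q (x - v)) :=
    hη.mono hu₁pos.le (hq.mem _ hs).le (hq.strictMono.monotone (by linarith))
  have h2 : c * (η u₁ / 2 * (x - y) ^ 2) ≤ C :=
    le_trans (by gcongr; linarith) hle
  have h3 : (x - y) ^ 2 ≤ 2 * C / (c * η u₁) := by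
    rw [le_div_iff₀ (by positivity)]; linarith
  nlinarith [sq_nonneg (x - y - 1)]

/-- The set where the residual does not point outwards is bounded. -/
lemma exists_bound_of_sum_residual_nonpos (hd : d = 2 ∨ d = 3) (hD : D.IsMesh Ω)
    (hΩ : Bornology.IsBounded Ω) (hΩc : IsConnected Ω) (hη : IsMobility η) (hp : IsPressure η p)
    (hq : IsPressureInverse p q) (hL : IsPermeability Ω L) (hm : ∀ b, 0 < P.mass D b)
    (hdt : 0 < dt) (hOld : ∀ b, uOld b ∈ closure (Ip p)) (hpos : ∃ b, uOld b ∈ Ip p) :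
    ∃ R, ∀ z : W M V, ∑ b, residual P D L η p Vext dt uOld (stateOf D q Vext z) b * z b ≤ 0 →
      ∀ b, |z b| ≤ R := by
  classical
  -- Adding these constants makes every time-derivative term nonnegative, so a bound on the whole
  -- sum bounds each term and each dissipation.
  choose C hC using fun b => hp.exists_neg_le_mul hq (hOld b) (D.potential Vext b)
  set μ : M ⊕ V → ℝ := fun b => P.mass D b / dt with hμ
  have hμpos : ∀ b, 0 < μ b := fun b => div_pos (hm b) hdt
  set C₀ := ∑ b, μ b * C b with hC₀
  set S : Set (W M V) := {z | ∑ b, residual P D L η p Vext dt uOld (stateOf D q Vext z) b * z b ≤ 0}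
  set f : W M V → M ⊕ V → ℝ := fun z b => (stateOf D q Vext z b - uOld b) * z b with hf
  have hfC : ∀ z b, 0 ≤ μ b * (f z b + C b) := fun z b => by
    have := hC b (z b - D.potential Vext b)
    rw [sub_add_cancel] at this
    exact mul_nonneg (hμpos b).le (by simp only [hf, stateOf]; linarith)
  have hdiss := fun z κ => dissipation_nonneg (η := η) hd hD hΩ hL (stateOf D q Vext z) z κ
  have hmain : ∀ z ∈ S, ∑ b, μ b * (f z b + C b)
      + ∑ κ, dissipation D L η (stateOf D q Vext z) z κ ≤ C₀ := by
    intro z hz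
    replace hz : ∑ b, residual P D L η p Vext dt uOld (stateOf D q Vext z) b * z b ≤ 0 := hz
    rw [sum_residual_stateOf_mul hq] at hz
    simp_rw [mul_add]
    rw [Finset.sum_add_distrib]
    linarith
  have hterm : ∀ z ∈ S, ∀ b, f z b ≤ C₀ / μ b - C b := by
    intro z hz b
    have h1 : μ b * (f z b + C b) ≤ C₀ := by
      refine le_trans (Finset.single_le_sum (fun b _ => hfC z b) (Finset.mem_univ b)) ?_
      linarith [hmain z hz, Finset.sum_nonneg fun κ (_ : κ ∈ Finset.univ) => hdiss z κ]
    rw [le_sub_iff_add_le, le_div_iff₀ (hμpos b)]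
    linarith
  have hdissle : ∀ z ∈ S, ∀ κ, dissipation D L η (stateOf D q Vext z) z κ ≤ C₀ := by
    intro z hz κ
    refine le_trans (Finset.single_le_sum (fun κ _ => hdiss z κ) (Finset.mem_univ κ)) ?_
    linarith [hmain z hz, Finset.sum_nonneg fun b (_ : b ∈ Finset.univ) => hfC z b]
  have hupper : ∀ b, ∃ K, ∀ z ∈ S, z b ≤ K := by
    intro b
    obtain ⟨K, hK⟩ := hq.exists_le_of_mul_le (uOld b) (D.potential Vext b) (C₀ / μ b - C b)
    refine ⟨K + D.potential Vext b, fun z hz => ?_⟩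
    have := hK (z b - D.potential Vext b) (by rw [sub_add_cancel]; exact hterm z hz b)
    linarith
  have hlower_of_mem : ∀ b, uOld b ∈ Ip p → ∃ K, ∀ z ∈ S, K ≤ z b := by
    intro b hb
    obtain ⟨K, hK⟩ := hq.exists_ge_of_mul_le hb (D.potential Vext b) (C₀ / μ b - C b)
    refine ⟨K + D.potential Vext b, fun z hz => ?_⟩
    have := hK (z b - D.potential Vext b) (by rw [sub_add_cancel]; exact hterm z hz b)
    linarith
  have hlower : ∀ b, ∃ K, ∀ z ∈ S, K ≤ z b := by
    by_cases hs : PressureSingular p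
    · obtain ⟨b₀, hb₀⟩ := hpos
      -- The propagated property is the existence of a lower bound of z at the node, uniform over
      -- `S`.
      refine hD.forall_of_propagates hd hΩ hΩc ?_ ?_ b₀ (hlower_of_mem b₀ hb₀)
      · rintro κ s hsκ ⟨K, hK⟩
        obtain ⟨c, hc, h⟩ := exists_mul_etaAvg_le_dissipation hd hD hΩ hL hη.nonneg κ
        obtain ⟨K', hK'⟩ := exists_lower_bound hs hη hq hc K
          (D.potential Vext (Sum.inl κ))
        refine ⟨K', fun z hz => hK' _ _ _ (hK z hz) ?_
          ((h (stateOf D q Vext z) z s hsκ).trans (hdissle z hz κ))⟩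
        simp only [MeshData.etaAvg, stateOf]
        linarith [hη.nonneg (q (z (Sum.inr s) - D.potential Vext (Sum.inr s)))]
      · rintro κ s hsκ ⟨K, hK⟩
        obtain ⟨c, hc, h⟩ := exists_mul_etaAvg_le_dissipation hd hD hΩ hL hη.nonneg κ
        obtain ⟨K', hK'⟩ := exists_lower_bound hs hη hq hc K
          (D.potential Vext (Sum.inr s))
        refine ⟨K', fun z hz => hK' _ _ (MeshData.etaAvg η (stateOf D q Vext z) κ s) (hK z hz) ?_ ?_⟩
        · simp only [MeshData.etaAvg, stateOf]
          linarith [hη.nonneg (q (z (Sum.inl κ) - D.potential Vext (Sum.inl κ)))]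
        -- From vertex to cell the jump has the opposite sign, which the square ignores.
        · rw [← neg_sub, neg_sq]
          exact (h (stateOf D q Vext z) z s hsκ).trans (hdissle z hz κ)
    · exact fun b => hlower_of_mem b fun h => absurd h hs
  choose K hK using hupper
  choose K' hK' using hlower
  refine ⟨∑ b, (|K b| + |K' b|), fun z hz b => ?_⟩
  refine le_trans ?_ (Finset.single_le_sum (f := fun b => |K b| + |K' b|)
    (fun b _ => by positivity) (Finset.mem_univ b))
  rw [abs_le]
  constructor
  · linarith [hK' b z hz, neg_abs_le (K' b), abs_nonneg (K b)]
  · linarith [hK b z hz, le_abs_self (K b), abs_nonneg (K' b)]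

/-- The residual, as a function of z, is placed on a Euclidean space where outward pointing can be
tested with the inner product. -/
lemma exists_solution (hd : d = 2 ∨ d = 3) (hD : D.IsMesh Ω)
    (hΩ : Bornology.IsBounded Ω) (hΩc : IsConnected Ω) (hη : IsMobility η) (hp : IsPressure η p)
    (hL : IsPermeability Ω L) (hm : ∀ b, 0 < P.mass D b)
    (hdt : 0 < dt) (hOld : ∀ b, uOld b ∈ closure (Ip p)) (hpos : ∃ b, uOld b ∈ Ip p) :
    ∃ u ∈ Admissible M V p, P.SolvesScheme D L η p Vext dt uOld u := by
  obtain ⟨q, hq⟩ := hp.exists_inverse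
  obtain ⟨R, hR⟩ := exists_bound_of_sum_residual_nonpos (P := P) (Vext := Vext) (dt := dt)
    hd hD hΩ hΩc hη hp hq hL hm hdt hOld hpos
  let G : EuclideanSpace ℝ (M ⊕ V) → EuclideanSpace ℝ (M ⊕ V) := fun z =>
    WithLp.toLp 2 (residual P D L η p Vext dt uOld (stateOf D q Vext (WithLp.ofLp z)))
  have hG : Continuous G := (PiLp.continuous_toLp 2 _).comp
    ((continuous_residual_stateOf hη.continuous hq).comp (PiLp.continuous_ofLp 2 _))
  have hinner : ∀ z, inner ℝ (G z) z
      = ∑ b, residual P D L η p Vext dt uOld (stateOf D q Vext (WithLp.ofLp z)) b * z b := by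
    intro z
    rw [PiLp.inner_apply]
    exact Finset.sum_congr rfl fun b _ => by simp [G, mul_comm]
  -- The extra 1 makes the radius positive and strictly larger than the norm of any z whose inner
  -- product with the field is nonpositive.
  set R' := √(∑ _b : M ⊕ V, R ^ 2) + 1 with hR'
  obtain ⟨z, hz⟩ := exists_zero_of_inner_pos hG (R := R') (by positivity) fun z hz => by
    by_contra! hneg
    rw [hinner] at hneg
    have hb := hR _ hneg
    have h1 : ‖z‖ ≤ √(∑ _b : M ⊕ V, R ^ 2) := by
      rw [EuclideanSpace.norm_eq]
      refine Real.sqrt_le_sqrt (Finset.sum_le_sum fun b _ => ?_)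
      rw [Real.norm_eq_abs]
      have := hb b
      gcongr
    linarith
  refine ⟨stateOf D q Vext (WithLp.ofLp z), fun b => hq.mem _, solvesScheme_iff.2 ?_⟩
  exact congrArg WithLp.ofLp hz

end VAG

/-! ### Existence and the entropy inequality for the scheme -/

theorem theorem1 {d : ℕ} (hd : d = 2 ∨ d = 3)
    {M F V : Type*} [Fintype M] [Fintype F] [Fintype V]
    [DecidableEq M] [DecidableEq F] [DecidableEq V]
    -- the domain and the data of the continuous problem
    (Ω : Set (VAG.Space d)) (hΩo : IsOpen Ω) (hΩc : IsConnected Ω) (hΩb : Bornology.IsBounded Ω)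
    (η p : ℝ → ℝ) (hη : VAG.IsMobility η) (hp : VAG.IsPressure η p) (hηp : VAG.IsCompatible η p)
    (L : VAG.Space d → VAG.Space d →L[ℝ] VAG.Space d) (hL : VAG.IsPermeability Ω L)
    (Vext : VAG.Space d → ℝ) (hV : ∃ K : ℝ≥0, LipschitzOnWith K Vext (closure Ω))
    -- the mesh, the mass lumping (with positive masses) and the time step
    (D : VAG.MeshData d M F V) (hD : D.IsMesh Ω)
    (P : VAG.Lumping d M V) (hP : P.IsLumping D) (hm : ∀ b, 0 < P.mass D b)
    (dt : ℝ) (hdt : 0 < dt)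
    -- the previous state, of positive total mass if `p(0) = -∞`
    (uOld : VAG.W M V) (hu : uOld ∈ P.FiniteEntropy D Ω p Vext)
    (hmass : VAG.PressureSingular p → 0 < ∫ x in Ω, P.reconD D uOld x) :
    (∃ u ∈ VAG.Admissible M V p, P.SolvesScheme D L η p Vext dt uOld u) ∧
    ∀ u ∈ VAG.Admissible M V p, P.SolvesScheme D L η p Vext dt uOld u →
      P.entropyD D Ω p Vext u
        + ((dt * ∑ κ, D.del κ (D.hydro p Vext u) ⬝ᵥ
            (D.matB L η κ u *ᵥ D.del κ (D.hydro p Vext u)) : ℝ) : EReal)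
        ≤ P.entropyD D Ω p Vext uOld := by
  have hOld := hP.mem_closure_of_finiteEntropy hd hD hΩb hm hu
  -- If p(0) = -∞, positive total mass forces a positive component. Otherwise any index serves, and
  -- there is one because cells cover the nonempty Ω.
  have hpos : ∃ b, uOld b ∈ VAG.Ip p := by
    by_cases hs : VAG.PressureSingular p
    · by_contra! hno
      have h1 := hP.integral_reconD hd hD hΩb (fun a _ => a) uOld uOld
      have h2 := hmass hs
      rw [h1] at h2
      refine h2.not_ge (Finset.sum_nonpos fun b _ => ?_)
      refine mul_nonpos_of_nonneg_of_nonpos (hm b).le (not_lt.1 fun h => hno b ?_)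
      exact VAG.mem_Ip_of_pos h
    · obtain ⟨x, hx⟩ := hΩc.nonempty
      have hx' : x ∈ ⋃ κ, closure (D.cell κ) := hD.cell_cover ▸ subset_closure hx
      obtain ⟨κ, -⟩ := mem_iUnion.1 hx'
      exact ⟨Sum.inl κ, fun h => absurd h hs⟩
  refine ⟨VAG.exists_solution hd hD hΩb hΩc hη hp hL hm hdt hOld hpos, fun u hu h => ?_⟩
  rw [hP.entropyD_eq hd hD hΩb hm hp Vext fun b => subset_closure (hu b),
    hP.entropyD_eq hd hD hΩb hm hp Vext hOld, ← EReal.coe_add, EReal.coe_le_coe_iff]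
  exact VAG.energy_inequality hp hm hdt hOld hu h
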